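/- **Definitions.** A PD0L system over a finite alphabet $\Sigma$ is a triple $\mathcal H=(\Sigma,H,s)$, where $H=(h_0,\dots,h_{p-1})$, $p\ge 1$, is a tuple of (possibly erasing) morphisms $h_i:\Sigma^*\to\Sigma^*$, which induces the map $H:\Sigma^*\to\Sigma^*$, $H(a_0a_1\cdots a_n)=u_0u_1\cdots u_n$ with $u_i=h_{i \bmod p}(a_i)$, and $s\in\Sigma^*$ is a prefix of $H(s)$. It is productive if the word $H^\omega(s)=\lim_{i\to\infty}H^i(s)$ is infinite; the limit is taken in the set of finite and infinite words over $\Sigma$, where two different words whose longest common prefix has length $n$ have distance $2^{-n}$. A Fractran program $F$ is a finite list of fractions $f_1,\dots,f_k$ with positive integer numerators and denominators. One step maps an integer $N\ge 1$ to $N\cdot f_i$, where $i$ is least with $N\cdot f_i\in\mathbb N$, and is undefined if there is no such $i$; $F$ halts on $N$ if the run $N,F(N),F^2(N),\dots$ is finite. Write $F$ as $\frac{z_1}{d},\dots,\frac{z_k}{d}$ with $d$ the least common multiple of the given denominators ($d=1$ if $k=0$), and let $\psi(i)$ be the least $j$ with $d\mid i z_j$, if there is one. The PD0L system $\mathcal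 H_F$ has the alphabet $\{\mathsf s,\sqcup,\mathsf a,\mathsf A,\mathsf b,\mathsf B\}$, the start word $\mathsf s$ and the morphisms $h_0,\dots,h_{d-1}$ with - $h_i(\mathsf s)=\mathsf s\,\sqcup^{d-1}\,\mathsf a\,\mathsf a\,\mathsf b\,\sqcup^{d-1}$ and $h_i(\sqcup)=\varepsilon$; - $h_{d-1}(\mathsf a)=\mathsf A\,\sqcup^{d-1}$ and $h_i(\mathsf a)=\varepsilon$ for $i\ne d-1$; - $h_i(\mathsf b)=\mathsf B\,\sqcup^{d-1-i}$; - $h_i(\mathsf A)=\mathsf a^{z_{\psi(i)}}$ and $h_i(\mathsf B)=\mathsf a^{i z_{\psi(i)}/d}\,\mathsf b\,\sqcup^{d-1}$ if $\psi(i)$ is defined, and $h_i(\mathsf A)=h_i(\mathsf B)=\varepsilon$ otherwise. **Theorem.** The problem of deciding, on the input of a PD0L system $\mathcal H$ (over an alphabet $\{0,\dots,n-1\}$, presented by $n$, the table of the values of its morphisms on letters, and its start word), whether $\mathcal H$ is productive, is $\Pi^0_1$-complete: the set of presentations of productive systems is $\Pi^0_1$, and for every $\Pi^0_1$ set $A\subseteq\mathbb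 N$ there is a computable map sending each $x\in\mathbb N$ to a presentation of a PD0L system that is productive if and only if $x\in A$. Moreover, the map that sends a Fractran program $F$ to (the presentation of) $\mathcal H_F$ is computable, and for every Fractran program $F$ the system $\mathcal H_F$ is productive if and only if $F$ does not halt on input $2$. -/

import Mathlib

/-! ### Finite and infinite words -/

/-- The set `Σ^∞` of all finite and infinite words over `α`: `Stream'.Seq α` is Mathlib's type of
possibly infinite sequences, and finite words embed by `Stream'.Seq.ofList`. -/
abbrev InfWord (α : Type*) := Stream'.Seq α

open Classical in
/-- The metric on `Σ^∞`: the distance of two different words is `2 ^ (-n)`, where `n` is the length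
of their longest common prefix, i.e. the first position at which they differ (a position behind the
end of a finite word carries `none`). The distance of a word to itself is `0`. -/
noncomputable def wordDist {α : Type*} (u v : InfWord α) : ℝ :=
  if u = v then 0 else (1 / 2 : ℝ) ^ sInf {k : ℕ | u.get? k ≠ v.get? k}

/-! ### D0L systems with periodic control -/

/-- The map `H` on words given by a tuple `(h₀, …, h_{p-1})` of morphisms, each of which is given by
its values on letters: `H (a₀ a₁ ⋯ aₙ) = u₀ u₁ ⋯ uₙ` with `uᵢ = h_{i mod p} (aᵢ)`. -/
def periodicMap {α : Type*} {p : ℕ} (hp : 0 < p) (h : Fin p → α → List α) (w : List α) : List α :=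
  (w.mapIdx fun i a => h ⟨i % p, Nat.mod_lt i hp⟩ a).flatten

/-- A PD0L system over the alphabet `α`. The morphisms are arbitrary, possibly erasing. -/
structure PD0LSystem (α : Type*) where
  /-- the number `p` of morphisms -/
  period : ℕ
  period_pos : 0 < period
  /-- the morphisms, by their values on letters -/
  morphism : Fin period → α → List α
  /-- the start word `s` -/
  start : List α
  start_prefix : start <+: periodicMap period_pos morphism start

namespace PD0LSystem

variable {α : Type*}

/-- The map `H` of the system. -/
def map (S : PD0LSystem α) : List α → List α :=
  periodicMap S.period_pos S.morphism

/-- `S.Generates x`: the word `x` is the limit `H^ω(s)` of the words `H^i(s)` in the metric space of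
finite and infinite words. -/
def Generates (S : PD0LSystem α) (x : InfWord α) : Prop :=
  Filter.Tendsto (fun i : ℕ => wordDist (Stream'.Seq.ofList (S.map^[i] S.start)) x)
    Filter.atTop (nhds 0)

/-- A system is productive if the word it generates is infinite. -/
def Productive (S : PD0LSystem α) : Prop :=
  ∃ x : InfWord α, S.Generates x ∧ ¬ x.Terminates

/-- The size `n` of the alphabet, the table of the values of the morphisms on the letters, and the
start word, of a system over the alphabet `{0, …, n-1}`. -/
def code : (Σ n : ℕ, PD0LSystem (Fin n)) → ℕ × List (List (List ℕ)) × List ℕ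
  | ⟨n, S⟩ =>
    (n, List.ofFn fun i => List.ofFn fun a => (S.morphism i a).map Fin.val, S.start.map Fin.val)

end PD0LSystem

/-! ### The class `Π⁰₁` -/

/-- A predicate is `Π⁰₁` if its complement is recursively enumerable. -/
def IsPi01 {C : Type*} [Primcodable C] (P : C → Prop) : Prop :=
  REPred fun c => ¬ P c

/-- The problem "given `i : I`, presented as `code i`, does `P i` hold?" is `Π⁰₁`-complete: the set
of codes of positive instances is `Π⁰₁`, and every `Π⁰₁` set of natural numbers is reduced to the
problem by a computable map that always returns (the code of) an instance. -/
def IsPi01Complete {I C : Type*} [Primcodable C] (code : I → C) (P : I → Prop) : Prop :=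
  (IsPi01 fun c : C => ∃ i, code i = c ∧ P i) ∧
    ∀ A : ℕ → Prop, IsPi01 A →
      ∃ f : ℕ → I, (Computable fun x => code (f x)) ∧ ∀ x, A x ↔ P (f x)

/-! ### Fractran -/

instance PNat.instPrimcodable : Primcodable ℕ+ :=
  Primcodable.subtype (p := fun n : ℕ => 0 < n) (Primrec.nat_lt.comp (Primrec.const 0) Primrec.id)

/-- A Fractran program: a finite list of fractions, given as pairs (numerator, denominator) of
positive integers. -/
abbrev FractranProgram := List (ℕ+ × ℕ+)

namespace FractranProgram

/-- One step of the program on `N`: multiply `N` by the first fraction `a / b` for which `N * a / b`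
is an integer; undefined if there is none. -/
def step (F : FractranProgram) (N : ℕ) : Option ℕ :=
  (F.find? fun f => decide ((f.2 : ℕ) ∣ N * (f.1 : ℕ))).map fun f => N * (f.1 : ℕ) / (f.2 : ℕ)

/-- The program halts on `N`: the run `N, F(N), F²(N), …` is finite. -/
def HaltsOn (F : FractranProgram) (N : ℕ) : Prop :=
  ∃ n : ℕ, (fun o : Option ℕ => o.bind F.step)^[n] (some N) = none

/-- The least common multiple `d` of the denominators. -/
def commonDen (F : FractranProgram) : ℕ :=
  F.foldr (fun f d => Nat.lcm (f.2 : ℕ) d) 1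

theorem commonDen_pos (F : FractranProgram) : 0 < F.commonDen := by
  induction F with
  | nil => exact Nat.one_pos
  | cons f F ih => exact Nat.lcm_pos f.2.pos ih

/-- The numerators `z₁, …, z_k` of the program written as `z₁/d, …, z_k/d` with `d` the common
denominator. -/
def commonNums (F : FractranProgram) : List ℕ :=
  F.map fun f => (f.1 : ℕ) * (F.commonDen / (f.2 : ℕ))

/-- The numerator `z_{ψ(i)}` of the first fraction of `z₁/d, …, z_k/d` that is applicable to `i`;
undefined if there is none. -/
def applicableNum (F : FractranProgram) (i : ℕ) : Option ℕ :=
  F.commonNums.find? fun z => decide (F.commonDen ∣ i * z)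

/-! The six letters of the alphabet of the encoding: the start letter `s`, a blank, and the letters
`a`, `A`, `b`, `B`. -/

/-- The letter `s`. -/
abbrev letS : Fin 6 := 0
/-- The blank. -/
abbrev letBlank : Fin 6 := 1
/-- The letter `a`. -/
abbrev letLowA : Fin 6 := 2
/-- The letter `A`. -/
abbrev letUpA : Fin 6 := 3
/-- The letter `b`. -/
abbrev letLowB : Fin 6 := 4
/-- The letter `B`. -/
abbrev letUpB : Fin 6 := 5

/-- The word of `n` blanks. -/
def blanks (n : ℕ) : List (Fin 6) := List.replicate n letBlank

/-- The word `aⁿ`. -/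
def lowAs (n : ℕ) : List (Fin 6) := List.replicate n letLowA

/-- The values of the `i`-th morphism on the letters `s`, blank, `a`, `A`, `b`, `B`, in this
order. -/
def encodingMorphism (F : FractranProgram) (i : Fin F.commonDen) : Fin 6 → List (Fin 6) :=
  let d := F.commonDen
  ![[letS] ++ blanks (d - 1) ++ [letLowA, letLowA, letLowB] ++ blanks (d - 1),
    [],
    if (i : ℕ) = d - 1 then [letUpA] ++ blanks (d - 1) else [],
    match F.applicableNum i with
    | some z => lowAs z
    | none => [],
    [letUpB] ++ blanks (d - 1 - i),
    match F.applicableNum i with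
    | some z => lowAs (i * z / d) ++ [letLowB] ++ blanks (d - 1)
    | none => []]

/-- The PD0L system that encodes the run of a Fractran program on input `2`. -/
def toPD0L (F : FractranProgram) : PD0LSystem (Fin 6) where
  period := F.commonDen
  period_pos := F.commonDen_pos
  morphism := F.encodingMorphism
  start := [letS]
  start_prefix := by
    simp [periodicMap, encodingMorphism]

end FractranProgram

/-! ### The words generated by a PD0L system -/

/-! Let `d` be the common denominator. Which fraction applies to `N` depends only on `N % d`
(`step_eq_map_applicableNum`), and a periodic control can read residues off positions. The generated
word is `s ⊔^(d-1)` followed alternately by `numberWord N` and `divisionWord N`, for the successive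
`N = q * d + r` of the run from `2`. A number word starts at a multiple of `d`; its image has one
`A` for each complete group of `d` letters `a`, and its `b`, at residue `r`, becomes `B`. The
division word starts at residue `r` and its letters `A` are `d` apart, so all of them and `B` meet
the morphism `h_r`, which knows the applicable numerator `z`. Together they emit `q * z + r * z / d
= N * z / d` letters `a`. A number word and its division word have total length divisible by `d`, so
the next number word is aligned again (`exists_iterate_of_run`). If no fraction applies, the
division word is erased and growth stops.

Since the start word is a prefix of its image, the iterates form a chain of prefixes, and
productivity means that they never become stationary (`productive_iff`). This yields the equivalence
with not halting, and also the upper bound: a presentation fails to be a positive instance iff it is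
invalid, which is decidable, or a search finds a stationary stage (`not_exists_code_eq_iff`).

For hardness, an r.e. set has the form `{x | ∃ k, g x k = 0}` with `g` primitive recursive. A loop
program computes `g` (`computes_of_primrec`), and a Fractran program simulates it with registers as
exponents of primes and further primes as labels (`Exec.simulates`). Searching for a zero of `g x`
then halts on `2` exactly when `x` is in the set. -/

theorem wordDist_nonneg {α : Type*} (u v : InfWord α) : 0 ≤ wordDist u v := by
  unfold wordDist
  split_ifs <;> positivity

theorem eq_of_wordDist_eq_zero {α : Type*} {u v : InfWord α} (h : wordDist u v = 0) : u = v := by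
  by_contra hne
  rw [wordDist, if_neg hne] at h
  exact absurd h (by positivity)

theorem wordDist_le {α : Type*} {u v : InfWord α} {n : ℕ}
    (h : ∀ k < n, u.get? k = v.get? k) : wordDist u v ≤ (1 / 2 : ℝ) ^ n := by
  unfold wordDist
  split_ifs with huv
  · positivity
  · apply pow_le_pow_of_le_one (by norm_num) (by norm_num)
    have hne : {k : ℕ | u.get? k ≠ v.get? k}.Nonempty := by
      by_contra hempty
      rw [Set.not_nonempty_iff_eq_empty, Set.eq_empty_iff_forall_notMem] at hempty
      exact huv (Stream'.Seq.ext fun k => not_not.1 (hempty k))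
    apply le_csInf hne
    intro k hk
    by_contra hlt
    exact hk (h k (not_le.1 hlt))

/-- The image of a word that stands at position `m`, under a tuple of morphisms. -/
def shiftedMap {α : Type*} {p : ℕ} (hp : 0 < p) (h : Fin p → α → List α) : ℕ → List α → List α
  | _, [] => []
  | m, a :: w => h ⟨m % p, Nat.mod_lt m hp⟩ a ++ shiftedMap hp h (m + 1) w

section shiftedMap

variable {α : Type*} {p : ℕ} (hp : 0 < p) (h : Fin p → α → List α)

theorem flatten_mapIdx_eq_shiftedMap (m : ℕ) (w : List α) :
    (w.mapIdx fun i a => h ⟨(m + i) % p, Nat.mod_lt (m + i) hp⟩ a).flatten =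
      shiftedMap hp h m w := by
  induction w generalizing m with
  | nil => simp [shiftedMap]
  | cons a w ih =>
    rw [List.mapIdx_cons, List.flatten_cons, shiftedMap, ← ih (m + 1)]
    simp only [Nat.add_zero, Nat.add_assoc, Nat.add_comm 1]

theorem periodicMap_eq_shiftedMap (w : List α) : periodicMap hp h w = shiftedMap hp h 0 w := by
  rw [← flatten_mapIdx_eq_shiftedMap, periodicMap]
  simp only [Nat.zero_add]

theorem shiftedMap_append (m : ℕ) (u v : List α) :
    shiftedMap hp h m (u ++ v) = shiftedMap hp h m u ++ shiftedMap hp h (m + u.length) v := by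
  induction u generalizing m with
  | nil => simp [shiftedMap]
  | cons a u ih =>
    simp only [List.cons_append, shiftedMap, ih, List.append_assoc, List.length_cons]
    rw [Nat.add_assoc, Nat.add_comm 1]

theorem shiftedMap_eq_nil (m : ℕ) (w : List α) (hw : ∀ a ∈ w, ∀ i, h i a = []) :
    shiftedMap hp h m w = [] := by
  induction w generalizing m with
  | nil => rfl
  | cons a w ih =>
    rw [shiftedMap, hw a (by simp), ih _ fun b hb => hw b (by simp [hb])]
    rfl

end shiftedMap

namespace PD0LSystem

variable {α : Type*} (S : PD0LSystem α)

/-- The image of a letter depends only on the letter and its position, and appending letters changes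
neither. -/
theorem map_prefix_map {u v : List α} (huv : u <+: v) : S.map u <+: S.map v := by
  obtain ⟨w, rfl⟩ := huv
  simp only [map, periodicMap_eq_shiftedMap, shiftedMap_append]
  exact List.prefix_append _ _

theorem iterate_prefix_succ (n : ℕ) : S.map^[n] S.start <+: S.map^[n + 1] S.start := by
  induction n with
  | zero => exact S.start_prefix
  | succ n ih =>
    rw [Function.iterate_succ_apply', Function.iterate_succ_apply' _ (n + 1)]
    exact S.map_prefix_map ih

theorem iterate_prefix {m n : ℕ} (hmn : m ≤ n) : S.map^[m] S.start <+: S.map^[n] S.start := by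
  induction n, hmn using Nat.le_induction with
  | base => exact List.prefix_rfl
  | succ n _ ih => exact ih.trans (S.iterate_prefix_succ n)

theorem iterate_eq_of_le {m n : ℕ} (hm : S.map^[m + 1] S.start = S.map^[m] S.start) (hmn : m ≤ n) :
    S.map^[n] S.start = S.map^[m] S.start := by
  induction n, hmn using Nat.le_induction with
  | base => rfl
  | succ n _ ih => rw [Function.iterate_succ_apply', ih, ← Function.iterate_succ_apply' S.map, hm]

theorem le_length_iterate (hS : ∀ n, S.map^[n + 1] S.start ≠ S.map^[n] S.start) (n : ℕ) :
    n ≤ (S.map^[n] S.start).length := by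
  induction n with
  | zero => exact Nat.zero_le _
  | succ n ih =>
    have hpre := S.iterate_prefix_succ n
    refine Nat.succ_le_of_lt (ih.trans_lt (lt_of_le_of_ne hpre.length_le fun hlen => ?_))
    exact hS n (hpre.eq_of_length hlen).symm

/-- A system is productive if and only if the words `H^n(s)` never become stationary. -/
theorem productive_iff :
    S.Productive ↔ ∀ n, S.map^[n + 1] S.start ≠ S.map^[n] S.start := by
  constructor
  · rintro ⟨x, hx, hinf⟩ n hn
    -- The distances are eventually constant, so their limit `0` is attained and `x` is a finite
    -- word.
    have hev : (fun i : ℕ => wordDist (Stream'.Seq.ofList (S.map^[i] S.start)) x)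
        =ᶠ[Filter.atTop] fun _ => wordDist (Stream'.Seq.ofList (S.map^[n] S.start)) x := by
      filter_upwards [Filter.eventually_ge_atTop n] with i hi
      rw [S.iterate_eq_of_le hn hi]
    have hlim := tendsto_nhds_unique (hx.congr' hev) tendsto_const_nhds
    have hxeq := eq_of_wordDist_eq_zero hlim.symm
    exact hinf (hxeq ▸ Stream'.Seq.terminates_ofList _)
  · intro hS
    have hlen := S.le_length_iterate hS
    -- Letter `k` is read from stage `k + 1`, the first stage certain to be long enough; later
    -- stages extend it.
    refine ⟨Stream'.Seq.ofStream fun k => (S.map^[k + 1] S.start)[k]'(hlen (k + 1)), ?_, ?_⟩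
    · refine squeeze_zero (fun _ => wordDist_nonneg _ _) (fun n => wordDist_le (n := n) ?_)
        (tendsto_pow_atTop_nhds_zero_of_lt_one (by norm_num) (by norm_num))
      intro k hk
      rw [Stream'.Seq.ofList_get?]
      refine Eq.trans ?_ (show some ((S.map^[k + 1] S.start)[k]'(hlen (k + 1))) = _ from rfl)
      rw [← List.getElem?_eq_getElem]
      obtain ⟨t, ht⟩ := S.iterate_prefix (Nat.succ_le_of_lt hk)
      rw [← ht, List.getElem?_append_left (hlen (k + 1))]
    · rintro ⟨n, hn⟩
      exact Option.some_ne_none _ hn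

end PD0LSystem

/-! ### Loop programs -/

/-- Programs on registers: increment a register, and `loop r P`, which decrements the register `r`
and runs `P` as long as `r` is not zero. -/
inductive LoopProgram where
  | skip : LoopProgram
  | inc (r : ℕ) : LoopProgram
  | seq (P Q : LoopProgram) : LoopProgram
  | loop (r : ℕ) (P : LoopProgram) : LoopProgram

namespace LoopProgram

/-- `Exec P σ τ`: started with the contents `σ` of the registers, `P` stops with the contents
`τ`. -/
inductive Exec : LoopProgram → (ℕ →₀ ℕ) → (ℕ →₀ ℕ) → Prop where
  | skip (σ : ℕ →₀ ℕ) : Exec skip σ σ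
  | inc (r : ℕ) (σ : ℕ →₀ ℕ) : Exec (inc r) σ (σ + Finsupp.single r 1)
  | seq {P Q : LoopProgram} {σ μ τ : ℕ →₀ ℕ} : Exec P σ μ → Exec Q μ τ → Exec (seq P Q) σ τ
  | loop_zero {r : ℕ} {P : LoopProgram} {σ : ℕ →₀ ℕ} : σ r = 0 → Exec (loop r P) σ σ
  | loop_succ {r : ℕ} {P : LoopProgram} {σ μ τ : ℕ →₀ ℕ} : Exec P σ μ → Exec (loop r P) μ τ →
      Exec (loop r P) (σ + Finsupp.single r 1) τ

open Finsupp in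
-- The rule for loop invariants: `σ i` describes the registers other than `r` after `i` rounds. The
-- body sees `n - 1 - i` in `r` because the decrement precedes it. The induction is on the number of
-- rounds left.
theorem exec_loop_single {r : ℕ} {P : LoopProgram} {σ : ℕ → ℕ →₀ ℕ}
    (hr : ∀ n, σ n r = 0) (n : ℕ)
    (hP : ∀ i < n, Exec P (σ i + single r (n - 1 - i)) (σ (i + 1) + single r (n - 1 - i))) :
    Exec (loop r P) (σ 0 + single r n) (σ n) := by
  have key : ∀ j ≤ n, Exec (loop r P) (σ (n - j) + single r j) (σ n) := by
    intro j
    induction j with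
    | zero => intro _; simpa using Exec.loop_zero (hr n)
    | succ j ih =>
      intro hj
      rw [single_add, ← add_assoc]
      refine Exec.loop_succ ?_ (ih (by omega))
      have h := hP (n - (j + 1)) (by omega)
      rwa [show n - 1 - (n - (j + 1)) = j by omega,
        show n - (j + 1) + 1 = n - j by omega] at h
  simpa using key n le_rfl

/-- Set a register to zero. -/
def clear (r : ℕ) : LoopProgram := loop r skip

/-- Add the register `a` to the register `b`, and set `a` to zero. -/
def move (a b : ℕ) : LoopProgram := loop a (inc b)

/-- Add the register `a` to the register `b`, with the help of a register `t` that is zero. -/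
def copy (a b t : ℕ) : LoopProgram := seq (loop a (seq (inc b) (inc t))) (move t a)

section

open Finsupp

theorem exec_clear {r : ℕ} {σ : ℕ →₀ ℕ} (hr : σ r = 0) (n : ℕ) :
    Exec (clear r) (σ + single r n) σ :=
  exec_loop_single (σ := fun _ => σ) (fun _ => hr) n fun _ _ => Exec.skip _

theorem exec_move {a b : ℕ} {σ : ℕ →₀ ℕ} (ha : σ a = 0) (hab : a ≠ b) (n : ℕ) :
    Exec (move a b) (σ + single a n) (σ + single b n) := by
  have h := exec_loop_single (r := a) (P := inc b) (σ := fun i => σ + single b i)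
    (fun i => by simp [ha, hab.symm]) n fun i _ => by
      convert Exec.inc b _ using 1
      rw [single_add]; abel
  simpa [move] using h

theorem exec_copy {a b t : ℕ} {σ : ℕ →₀ ℕ} (ht : σ t = 0) (hab : a ≠ b) (hat : a ≠ t)
    (hbt : b ≠ t) : Exec (copy a b t) σ (σ + single b (σ a)) := by
  -- Splitting off the register `a` makes it the loop counter; its content goes to both `b` and `t`,
  -- and is then moved back from `t`.
  have hσ : σ.erase a + single a (σ a) = σ := erase_add_single a σ
  have h := exec_loop_single (r := a) (P := seq (inc b) (inc t))
    (σ := fun i => σ.erase a + single b i + single t i)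
    (fun i => by simp [hab.symm, hat.symm]) (σ a) fun i _ => by
      refine Exec.seq (Exec.inc b _) ?_
      convert Exec.inc t _ using 1
      rw [single_add, single_add]; abel
  have h' := exec_move (a := t) (b := a) (σ := σ.erase a + single b (σ a))
    (by simp [ht, hbt, hat.symm]) hat.symm (σ a)
  refine Exec.seq (μ := σ.erase a + single b (σ a) + single t (σ a)) ?_ ?_
  · simpa [hσ] using h
  · convert h' using 1
    nth_rw 1 [← hσ]; abel

/-- The program `P i` for `i < n`, one after the other. -/
def seqAll (P : ℕ → LoopProgram) : ℕ → LoopProgram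
  | 0 => skip
  | n + 1 => seq (seqAll P n) (P n)

theorem exec_seqAll {P : ℕ → LoopProgram} {n : ℕ} {σ : ℕ → ℕ →₀ ℕ}
    (h : ∀ i < n, Exec (P i) (σ i) (σ (i + 1))) : Exec (seqAll P n) (σ 0) (σ n) := by
  induction n with
  | zero => exact Exec.skip _
  | succ n ih => exact Exec.seq (ih fun i hi => h i (by omega)) (h n (by omega))

/-! ### Loop programs compute all primitive recursive functions -/

/-- `Computes f`: for all choices of input registers, an output register outside of them, and a
bound `k` for the registers in use, some program adds the value of `f` to the output register. It
relies on the registers from `k` on being zero, and restores this. -/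
def Computes {n : ℕ} (f : List.Vector ℕ n → ℕ) : Prop :=
  ∀ (ρ : Fin n → ℕ) (o k : ℕ), (∀ i, ρ i < k) → o < k → (∀ i, ρ i ≠ o) →
    ∃ P : LoopProgram, ∀ σ : ℕ →₀ ℕ, (∀ j, k ≤ j → σ j = 0) →
      Exec P σ (σ + single o (f (List.Vector.ofFn fun i => σ (ρ i))))

theorem computes_zero : Computes (n := 0) fun _ => 0 := fun _ _ _ _ _ _ =>
  ⟨skip, fun σ _ => by simpa using Exec.skip σ⟩

theorem computes_get {n : ℕ} (i : Fin n) : Computes fun v => v.get i := fun ρ o k hρ ho hρo =>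
  ⟨copy (ρ i) o k, fun σ hσ => by
    simpa using exec_copy (hσ k le_rfl) (hρo i) (hρ i).ne ho.ne⟩

theorem computes_succ : Computes (n := 1) fun v => Nat.succ v.head := fun ρ o k hρ ho hρo =>
  ⟨seq (copy (ρ 0) o k) (inc o), fun σ hσ => by
    have h := Exec.seq (exec_copy (hσ k le_rfl) (hρo 0) (hρ 0).ne ho.ne) (Exec.inc o _)
    simpa [add_assoc, ← single_add] using h⟩

/-- The registers `k, …, k + n - 1` hold the intermediate values and are cleared afterwards; all
subprograms use the raised bound `k + n`. -/
theorem computes_comp {m n : ℕ} {f : List.Vector ℕ n → ℕ} (g : Fin n → List.Vector ℕ m → ℕ)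
    (hf : Computes f) (hg : ∀ i, Computes (g i)) :
    Computes fun a => f (List.Vector.ofFn fun i => g i a) := by
  intro ρ o k hρ ho hρo
  have hG : ∀ i : Fin n, ∃ P : LoopProgram, ∀ σ : ℕ →₀ ℕ, (∀ j, k + n ≤ j → σ j = 0) →
      Exec P σ (σ + single (k + i) (g i (List.Vector.ofFn fun i => σ (ρ i)))) := fun i =>
    hg i ρ (k + i) (k + n) (fun j => (hρ j).trans_le (by omega)) (by omega)
      (fun j => ((hρ j).trans_le (by omega)).ne)
  choose G hG using hG
  obtain ⟨P, hP⟩ := hf (fun i => k + i) o (k + n) (fun i => by simp) (by omega)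
    (fun i => by omega)
  refine ⟨seq (seq (seqAll (fun i => if h : i < n then G ⟨i, h⟩ else skip) n) P)
    (seqAll (fun i => clear (k + i)) n), fun σ hσ => ?_⟩
  set v := List.Vector.ofFn fun i => σ (ρ i) with hv
  let y : ℕ → ℕ := fun i => if h : i < n then g ⟨i, h⟩ v else 0
  -- The intermediate registers are at `s 0 i` while they are being filled and at `s i n` while they
  -- are being cleared.
  let s : ℕ → ℕ → ℕ →₀ ℕ := fun a b => ∑ i ∈ Finset.Ico a b, single (k + i) (y i)
  have hs : ∀ a b j, j < k ∨ k + b ≤ j → s a b j = 0 := by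
    intro a b j hj
    simp only [s, finsetSum_apply]
    refine Finset.sum_eq_zero fun i hi => ?_
    rw [Finset.mem_Ico] at hi
    exact single_eq_of_ne (by omega)
  refine Exec.seq (μ := σ + s 0 n + single o (f (List.Vector.ofFn fun i => g i v)))
    (Exec.seq (μ := σ + s 0 n) ?_ ?_) ?_
  · have h := exec_seqAll (P := fun i => if h : i < n then G ⟨i, h⟩ else skip) (n := n)
      (σ := fun i => σ + s 0 i) fun i hi => by
        have h := hG ⟨i, hi⟩ (σ + s 0 i) fun j hj => by
          simp [hσ j (by omega), hs 0 i j (by omega)]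
        have hvi : (List.Vector.ofFn fun l => (σ + s 0 i) (ρ l)) = v := by
          simp [hv, hs 0 i _ (Or.inl (hρ _))]
        rw [hvi] at h
        simp only [hi, dite_true]
        convert h using 1
        simp only [s, Finset.sum_Ico_succ_top (Nat.zero_le i), y, hi, dite_true, add_assoc]
    simpa [s] using h
  · have h := hP (σ + s 0 n) fun j hj => by
      simp [hσ j (by omega), hs 0 n j (by omega)]
    have hy : (List.Vector.ofFn fun i : Fin n => (σ + s 0 n) (k + i)) =
        List.Vector.ofFn fun i => g i v := by
      congr 1
      funext i
      simp only [coe_add, Pi.add_apply, hσ (k + i) (by omega), zero_add, s, finsetSum_apply]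
      rw [Finset.sum_eq_single (i : ℕ)]
      · simp [y]
      · intro b _ hb
        exact single_eq_of_ne (by omega)
      · intro h
        simp at h
    rwa [hy] at h
  · have h := exec_seqAll (P := fun i => clear (k + i)) (n := n)
      (σ := fun i => σ + single o (f (List.Vector.ofFn fun i => g i v)) + s i n) fun i hi => by
        have h := exec_clear (r := k + i)
          (σ := σ + single o (f (List.Vector.ofFn fun i => g i v)) + s (i + 1) n) (by
            simp only [coe_add, Pi.add_apply, hσ (k + i) (by omega), zero_add, s, finsetSum_apply]
            rw [single_eq_of_ne (by omega), zero_add]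
            refine Finset.sum_eq_zero fun j hj => ?_
            rw [Finset.mem_Ico] at hj
            exact single_eq_of_ne (by omega)) (y i)
        convert h using 1
        simp only [s]
        rw [Finset.sum_eq_sum_Ico_succ_bot hi]
        abel
    convert h using 1
    · abel
    · simp [s]

/-- Register `k` counts the rounds down, `k + 1` holds the recursion index, `k + 2` the current
value and `k + 3` the next one. Both subprograms get the bound `k + 4`. -/
theorem computes_prec {n : ℕ} {f : List.Vector ℕ n → ℕ} {g : List.Vector ℕ (n + 2) → ℕ}
    (hf : Computes f) (hg : Computes g) :
    Computes fun v : List.Vector ℕ (n + 1) =>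
      v.head.rec (f v.tail) fun y IH => g (y ::ᵥ IH ::ᵥ v.tail) := by
  intro ρ o k hρ ho hρo
  obtain ⟨F, hF⟩ := hf (fun i => ρ i.succ) (k + 2) (k + 4)
    (fun i => (hρ _).trans_le (by omega)) (by omega)
    (fun i => ((hρ _).trans_le (by omega)).ne)
  obtain ⟨G, hG⟩ := hg (Fin.cons (k + 1) (Fin.cons (k + 2) fun i => ρ i.succ)) (k + 3) (k + 4)
    (fun i => by
      refine Fin.cases (by simp) (fun i => ?_) i
      refine Fin.cases (by simp) (fun i => ?_) i
      simpa using (hρ i.succ).trans_le (by omega)) (by omega)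
    (fun i => by
      refine Fin.cases (by simp) (fun i => ?_) i
      refine Fin.cases (by simp) (fun i => ?_) i
      simpa using ((hρ i.succ).trans_le (by omega)).ne)
  refine ⟨seq (seq (seq (copy (ρ 0) k (k + 1)) F)
    (loop k (seq (seq (seq G (clear (k + 2))) (move (k + 3) (k + 2))) (inc (k + 1)))))
    (seq (clear (k + 1)) (move (k + 2) o)), fun σ hσ => ?_⟩
  set v := List.Vector.ofFn fun i => σ (ρ i) with hv
  let x := σ (ρ 0)
  have hvt : (List.Vector.ofFn fun i : Fin n => σ (ρ i.succ)) = v.tail := by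
    rw [hv, List.Vector.tail_ofFn]
  have hvh : v.head = x := by simp [hv, x]
  let R : ℕ → ℕ := fun j => Nat.rec (f v.tail) (fun y IH => g (y ::ᵥ IH ::ᵥ v.tail)) j
  have hRs : ∀ j, R (j + 1) = g (j ::ᵥ R j ::ᵥ v.tail) := fun _ => rfl
  beta_reduce
  rw [hvh]
  change Exec _ σ (σ + single o (R x))
  have hne : ∀ i : Fin (n + 1), ∀ j, k ≤ j → j ≠ ρ i := fun i j hj => ((hρ i).trans_le hj).ne'
  refine Exec.seq (μ := σ + single (k + 1) x + single (k + 2) (R x)) (Exec.seq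
    (μ := σ + single (k + 1) 0 + single (k + 2) (R 0) + single k x)
    (Exec.seq (μ := σ + single k x) ?_ ?_) ?_)
    (Exec.seq (μ := σ + single (k + 2) (R x)) ?_ ?_)
  · exact exec_copy (hσ _ (by omega)) (hρ 0).ne ((hρ 0).trans_le (by omega)).ne (by omega)
  · have h := hF (σ + single k x) fun j hj => by
      rw [Finsupp.add_apply, hσ j (by omega), single_eq_of_ne (by omega)]
      rfl
    convert h using 1
    have : (List.Vector.ofFn fun i : Fin n => (σ + single k x) (ρ i.succ)) = v.tail := by
      rw [← hvt]
      congr 1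
      funext i
      rw [Finsupp.add_apply, single_eq_of_ne (hne _ _ le_rfl).symm, add_zero]
    rw [this, single_zero]
    change _ = σ + single k x + single (k + 2) (R 0)
    abel
  -- Invariant: after `j` rounds the index is `j` and the current value is `R j`.
  · refine exec_loop_single (σ := fun j => σ + single (k + 1) j + single (k + 2) (R j))
      (fun j => by
        simp only [Finsupp.add_apply]
        rw [hσ k le_rfl, single_eq_of_ne (by omega), single_eq_of_ne (by omega)]
        rfl) x fun j _ => ?_
    generalize x - 1 - j = c
    refine Exec.seq (μ := σ + single (k + 1) j + single k c + single (k + 2) (R (j + 1)))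
      (Exec.seq (μ := σ + single (k + 1) j + single k c + single (k + 3) (R (j + 1)))
        (Exec.seq (μ := σ + single (k + 1) j + single k c + single (k + 3) (R (j + 1)) +
          single (k + 2) (R j)) ?_ ?_) ?_) ?_
    · have h := hG (σ + single (k + 1) j + single (k + 2) (R j) + single k c) fun i hi => by
        simp only [Finsupp.add_apply]
        rw [hσ i (by omega), single_eq_of_ne (by omega), single_eq_of_ne (by omega),
          single_eq_of_ne (by omega)]
        rfl
      convert h using 1
      rw [hRs, List.Vector.ofFn, List.Vector.ofFn]
      have h1 : (σ + single (k + 1) j + single (k + 2) (R j) + single k c) (k + 1) = j := by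
        simp only [Finsupp.add_apply]
        rw [hσ _ (by omega), single_eq_of_ne (a := k + 2) (by omega),
          single_eq_of_ne (a := k) (by omega), single_eq_same]
        omega
      have h2 : (σ + single (k + 1) j + single (k + 2) (R j) + single k c) (k + 2) = R j := by
        simp only [Finsupp.add_apply]
        rw [hσ _ (by omega), single_eq_of_ne (a := k + 1) (by omega),
          single_eq_of_ne (a := k) (by omega), single_eq_same]
        omega
      have h3 : (List.Vector.ofFn fun i : Fin n =>
          (σ + single (k + 1) j + single (k + 2) (R j) + single k c) (ρ i.succ)) = v.tail := by
        rw [← hvt]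
        congr 1
        funext i
        simp only [Finsupp.add_apply]
        rw [single_eq_of_ne (hne _ _ (by omega)).symm, single_eq_of_ne (hne _ _ (by omega)).symm,
          single_eq_of_ne (hne _ _ (by omega)).symm]
        rfl
      simp only [Fin.cons_zero, Fin.cons_succ, h1, h2, h3]
      abel
    · refine exec_clear ?_ _
      simp only [Finsupp.add_apply]
      rw [hσ _ (by omega), single_eq_of_ne (by omega), single_eq_of_ne (by omega),
        single_eq_of_ne (by omega)]
      rfl
    · refine exec_move ?_ (by omega) _
      simp only [Finsupp.add_apply]
      rw [hσ _ (by omega), single_eq_of_ne (by omega), single_eq_of_ne (by omega)]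
      rfl
    · convert Exec.inc (k + 1) _ using 1
      rw [single_add]
      abel
  · have h := exec_clear (r := k + 1) (σ := σ + single (k + 2) (R x)) (by
      rw [Finsupp.add_apply, hσ _ (by omega), single_eq_of_ne (by omega)]; rfl) x
    convert h using 1
    abel
  · exact exec_move (hσ _ (by omega)) (by omega) _

theorem computes_of_primrec {n : ℕ} {f : List.Vector ℕ n → ℕ} (hf : Nat.Primrec' f) :
    Computes f := by
  induction hf with
  | zero => exact computes_zero
  | succ => exact computes_succ
  | get i => exact computes_get i
  | comp g _ _ hf hg => exact computes_comp g hf hg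
  | prec _ _ hf hg => exact computes_prec hf hg

end

end LoopProgram

/-! ### Runs of Fractran programs -/

namespace FractranProgram

variable (F : FractranProgram)

/-- The state after `n` steps, if the program did not halt before. -/
def run (N : ℕ) (n : ℕ) : Option ℕ := (fun o : Option ℕ => o.bind F.step)^[n] (some N)

theorem run_succ (N n : ℕ) : F.run N (n + 1) = (F.run N n).bind F.step :=
  Function.iterate_succ_apply' _ _ _

theorem run_add_one_of_step {N M : ℕ} (h : F.step N = some M) (n : ℕ) :
    F.run N (n + 1) = F.run M n := by
  rw [run, Function.iterate_succ_apply, Option.bind_some, h, run]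

theorem haltsOn_iff (N : ℕ) : F.HaltsOn N ↔ ∃ n, F.run N n = none := Iff.rfl

/-- `F.Steps N M`: one step of the program leads from `N` to `M`. -/
def Steps (N M : ℕ) : Prop := F.step N = some M

variable {F}

theorem haltsOn_of_step_eq_none {N : ℕ} (h : F.step N = none) : F.HaltsOn N :=
  ⟨1, by simpa using h⟩

theorem HaltsOn.of_steps {N M : ℕ} (hM : F.HaltsOn M) (h : F.Steps N M) : F.HaltsOn N :=
  let ⟨n, hn⟩ := hM
  ⟨n + 1, (F.run_add_one_of_step h n).trans hn⟩

theorem HaltsOn.of_reaches {N M : ℕ} (hM : F.HaltsOn M)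
    (h : Relation.ReflTransGen F.Steps N M) : F.HaltsOn N := by
  induction h using Relation.ReflTransGen.head_induction_on with
  | refl => exact hM
  | head h _ ih => exact ih.of_steps h

/-- At least one step has been used up, so the halting time strictly drops. This is the descent
behind `not_haltsOn_of_transGen`. -/
theorem exists_run_eq_none_of_transGen {N M : ℕ} (h : Relation.TransGen F.Steps N M) {n : ℕ}
    (hn : F.run N n = none) : ∃ m < n, F.run M m = none := by
  have single {N M n : ℕ} (h : F.Steps N M) (hn : F.run N n = none) :
      ∃ m < n, F.run M m = none := by
    cases n with
    | zero => cases hn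
    | succ n => exact ⟨n, n.lt_succ_self, (F.run_add_one_of_step h n).symm.trans hn⟩
  induction h with
  | single h => exact single h hn
  | tail _ h ih =>
    obtain ⟨m, hm, hrun⟩ := ih
    obtain ⟨l, hl, hrun⟩ := single h hrun
    exact ⟨l, hl.trans hm, hrun⟩

theorem not_haltsOn_of_transGen {N : ℕ → ℕ}
    (h : ∀ i, Relation.TransGen F.Steps (N i) (N (i + 1))) : ¬ F.HaltsOn (N 0) := by
  have key : ∀ n i, F.run (N i) n ≠ none := by
    intro n
    induction n using Nat.strong_induction_on with
    | _ n ih =>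
      intro i hi
      obtain ⟨m, hm, hrun⟩ := exists_run_eq_none_of_transGen (h i) hi
      exact ih m hm _ hrun
  rintro ⟨n, hn⟩
  exact key n 0 hn

/-- The fraction `f` is the first applicable one, so `B` plays no role. The product form of `hM`
avoids division and does not require `f` to be reduced. -/
theorem steps_append {A B : FractranProgram} {N : ℕ} {f : ℕ+ × ℕ+} {M : ℕ}
    (hA : ∀ f ∈ A, ¬ (f.2 : ℕ) ∣ N * f.1) (hM : N * f.1 = M * f.2) :
    (A ++ f :: B).Steps N M := by
  have hfind : (A ++ f :: B).find? (fun f => decide ((f.2 : ℕ) ∣ N * (f.1 : ℕ))) = some f := by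
    rw [List.find?_append, List.find?_eq_none.2 (by simpa using hA), Option.none_or,
      List.find?_cons_of_pos]
    simp [hM]
  rw [Steps, step, hfind, Option.map_some, hM, Nat.mul_div_cancel _ f.2.pos]

theorem step_eq_none {N : ℕ} (hF : ∀ f ∈ F, ¬ (f.2 : ℕ) ∣ N * f.1) : F.step N = none := by
  rw [step, List.find?_eq_none.2 (by simpa using hF), Option.map_none]

end FractranProgram

/-! ### Loop programs as Fractran programs -/

namespace LoopProgram

theorem nth_prime_prime (n : ℕ) : (Nat.nth Nat.Prime n).Prime :=
  Nat.nth_mem_of_infinite Nat.infinite_setOfPred_prime n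

/-- The prime that stands for a label. -/
noncomputable def labelPrime (l : ℕ) : ℕ+ :=
  ⟨Nat.nth Nat.Prime (2 * l), (nth_prime_prime _).pos⟩

/-- The prime whose exponent is the content of a register. -/
noncomputable def registerPrime (r : ℕ) : ℕ+ :=
  ⟨Nat.nth Nat.Prime (2 * r + 1), (nth_prime_prime _).pos⟩

theorem labelPrime_prime (l : ℕ) : (labelPrime l : ℕ).Prime := nth_prime_prime _

theorem registerPrime_prime (r : ℕ) : (registerPrime r : ℕ).Prime := nth_prime_prime _

theorem coe_labelPrime_zero : (labelPrime 0 : ℕ) = 2 := Nat.nth_prime_zero_eq_two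

/-- Labels take the primes of even index and registers those of odd index, so all divisibilities
among them become linear arithmetic on indices. -/
theorem nth_prime_dvd_iff {m n : ℕ} : Nat.nth Nat.Prime m ∣ Nat.nth Nat.Prime n ↔ m = n := by
  rw [Nat.prime_dvd_prime_iff_eq (nth_prime_prime m) (nth_prime_prime n)]
  exact (Nat.nth_injective Nat.infinite_setOfPred_prime).eq_iff

theorem labelPrime_dvd_labelPrime {l m : ℕ} : (labelPrime l : ℕ) ∣ labelPrime m ↔ l = m :=
  nth_prime_dvd_iff.trans (by omega)

theorem registerPrime_dvd_registerPrime {r s : ℕ} :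
    (registerPrime r : ℕ) ∣ registerPrime s ↔ r = s :=
  nth_prime_dvd_iff.trans (by omega)

theorem not_labelPrime_dvd_registerPrime (l r : ℕ) : ¬ (labelPrime l : ℕ) ∣ registerPrime r :=
  nth_prime_dvd_iff.not.2 (by omega)

theorem not_registerPrime_dvd_labelPrime (l r : ℕ) : ¬ (registerPrime r : ℕ) ∣ labelPrime l :=
  nth_prime_dvd_iff.not.2 (by omega)

/-- The number that encodes the contents of the registers. -/
noncomputable def registerValue (σ : ℕ →₀ ℕ) : ℕ := σ.prod fun r e => (registerPrime r : ℕ) ^ e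

theorem registerValue_add (σ τ : ℕ →₀ ℕ) :
    registerValue (σ + τ) = registerValue σ * registerValue τ :=
  Finsupp.prod_add_index' (fun _ => pow_zero _) fun _ _ _ => pow_add _ _ _

theorem registerValue_single (r n : ℕ) :
    registerValue (Finsupp.single r n) = (registerPrime r : ℕ) ^ n :=
  Finsupp.prod_single_index (pow_zero _)

theorem not_labelPrime_dvd_registerValue (l : ℕ) (σ : ℕ →₀ ℕ) :
    ¬ (labelPrime l : ℕ) ∣ registerValue σ := by
  rw [registerValue, Finsupp.prod, (labelPrime_prime l).prime.dvd_finsetProd_iff]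
  rintro ⟨r, -, h⟩
  exact not_labelPrime_dvd_registerPrime l r ((labelPrime_prime l).dvd_of_dvd_pow h)

theorem not_registerPrime_dvd_registerValue {r : ℕ} {σ : ℕ →₀ ℕ} (hr : σ r = 0) :
    ¬ (registerPrime r : ℕ) ∣ registerValue σ := by
  rw [registerValue, Finsupp.prod, (registerPrime_prime r).prime.dvd_finsetProd_iff]
  rintro ⟨s, hs, h⟩
  have := registerPrime_dvd_registerPrime.1 ((registerPrime_prime r).dvd_of_dvd_pow h)
  subst this
  simp [hr] at hs

/-- The number of labels of the translation of a program, without the final one. -/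
def size : LoopProgram → ℕ
  | skip => 0
  | inc _ => 1
  | seq P Q => P.size + Q.size
  | loop _ P => P.size + 2

/-- The translation of a program into a Fractran program. It is entered at the label `l` and left
at the label `l + P.size`. -/
noncomputable def toFractran : LoopProgram → ℕ → FractranProgram
  | skip, _ => []
  | inc r, l => [(labelPrime (l + 1) * registerPrime r, labelPrime l)]
  | seq P Q, l => P.toFractran l ++ Q.toFractran (l + P.size)
  | loop r P, l =>
    (labelPrime (l + 1), labelPrime l * registerPrime r) ::
      (labelPrime (l + (P.size + 2)), labelPrime l) ::
        (P.toFractran (l + 1) ++ [(labelPrime l, labelPrime (l + 1 + P.size))])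

/-- `Below l f`: the fraction `f` is applicable only at a label less than `l`. -/
def Below (l : ℕ) (f : ℕ+ × ℕ+) : Prop :=
  ∃ i < l, (labelPrime i : ℕ) ∣ f.2 ∧ ¬ (labelPrime i : ℕ) ∣ f.1

theorem Below.mono {l m : ℕ} {f : ℕ+ × ℕ+} (h : Below l f) (hlm : l ≤ m) : Below m f :=
  let ⟨i, hi, h⟩ := h
  ⟨i, hi.trans_le hlm, h⟩

/-- The state contains no label prime other than that of `l`. The prime of the smaller label in the
denominator cannot be supplied by the numerator either, which is why `Below` has its second clause.
-/
theorem Below.not_dvd {l : ℕ} {f : ℕ+ × ℕ+} (h : Below l f) (σ : ℕ →₀ ℕ) :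
    ¬ (f.2 : ℕ) ∣ labelPrime l * registerValue σ * f.1 := by
  obtain ⟨i, hi, h2, h1⟩ := h
  intro hdvd
  rcases (labelPrime_prime i).dvd_mul.1 (h2.trans hdvd) with h | h
  · rcases (labelPrime_prime i).dvd_mul.1 h with h | h
    · exact hi.ne (labelPrime_dvd_labelPrime.1 h)
    · exact not_labelPrime_dvd_registerValue i σ h
  · exact h1 h

theorem below_inc {l r : ℕ} {f : ℕ+ × ℕ+} (hf : f ∈ (inc r).toFractran l) : Below (l + 1) f := by
  obtain rfl := List.mem_singleton.1 hf
  refine ⟨l, by omega, dvd_rfl, fun h => ?_⟩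
  rw [PNat.mul_coe] at h
  rcases (labelPrime_prime l).dvd_mul.1 h with h | h
  · exact absurd (labelPrime_dvd_labelPrime.1 h) (by omega)
  · exact not_labelPrime_dvd_registerPrime _ _ h

theorem below_loop_enter (l r : ℕ) :
    Below (l + 1) (labelPrime (l + 1), labelPrime l * registerPrime r) :=
  ⟨l, by omega, by simp, labelPrime_dvd_labelPrime.not.2 (by omega)⟩

theorem below_goto {l m : ℕ} (hlm : l ≠ m) : Below (l + 1) (labelPrime m, labelPrime l) :=
  ⟨l, by omega, dvd_rfl, labelPrime_dvd_labelPrime.not.2 hlm⟩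

theorem below_toFractran (P : LoopProgram) (l : ℕ) :
    ∀ f ∈ P.toFractran l, Below (l + P.size) f := by
  induction P generalizing l with
  | skip => simp [toFractran]
  | inc r => exact fun f => below_inc
  | seq P Q hP hQ =>
    intro f hf
    rcases List.mem_append.1 hf with hf | hf
    · exact (hP _ f hf).mono (by simp only [size]; omega)
    · exact (hQ _ f hf).mono (by simp only [size]; omega)
  | loop r P hP =>
    intro f hf
    simp only [toFractran, List.mem_cons, List.mem_append, List.not_mem_nil, or_false] at hf
    simp only [size]
    rcases hf with rfl | rfl | hf | rfl
    · exact (below_loop_enter l r).mono (by omega)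
    · exact (below_goto (by omega)).mono (by omega)
    · exact (hP _ f hf).mono (by omega)
    · exact (below_goto (by omega)).mono (by omega)

open Relation FractranProgram

/-- The runs of the translation of `P`, wherever it stands, lead from `σ` to `τ`. -/
def Simulates (P : LoopProgram) (σ τ : ℕ →₀ ℕ) : Prop :=
  ∀ (l : ℕ) (A B : FractranProgram), (∀ f ∈ A, Below l f) →
    ReflTransGen (FractranProgram.Steps (A ++ P.toFractran l ++ B))
      (labelPrime l * registerValue σ) (labelPrime (l + P.size) * registerValue τ)

/-- One round: the entry fraction consumes a factor of the prime of `r`, the body runs from label `l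
+ 1`, and the last fraction jumps back. `TransGen` records that a round takes time, as needed for
proving that a search does not halt. -/
theorem transGen_loop_body {P : LoopProgram} {r : ℕ} {σ τ : ℕ →₀ ℕ} (h : Simulates P σ τ) (l : ℕ)
    (A B : FractranProgram) (hA : ∀ f ∈ A, Below l f) :
    TransGen (FractranProgram.Steps (A ++ (loop r P).toFractran l ++ B))
      (labelPrime l * registerValue (σ + Finsupp.single r 1))
      (labelPrime l * registerValue τ) := by
  have hA' : ∀ f ∈ A ++ [(labelPrime (l + 1), labelPrime l * registerPrime r),
      (labelPrime (l + (P.size + 2)), labelPrime l)], Below (l + 1) f := by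
    intro f hf
    simp only [List.mem_append, List.mem_cons, List.not_mem_nil, or_false] at hf
    rcases hf with hf | rfl | rfl
    · exact (hA f hf).mono (by omega)
    · exact below_loop_enter l r
    · exact below_goto (by omega)
  -- For the body, the two head fractions belong to the code before it, and the jump back to the
  -- code behind it.
  have hP := h (l + 1) _ ([(labelPrime l, labelPrime (l + 1 + P.size))] ++ B) hA'
  refine TransGen.tail' (ReflTransGen.head ?_ (by simpa [toFractran] using hP)) ?_
  · simp only [toFractran, List.append_assoc, List.cons_append]
    refine steps_append (fun f hf => (hA f hf).not_dvd _) ?_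
    rw [registerValue_add, registerValue_single, PNat.mul_coe]
    ring
  · have hs := steps_append (N := labelPrime (l + 1 + P.size) * registerValue τ)
      (A := (A ++ [(labelPrime (l + 1), labelPrime l * registerPrime r),
        (labelPrime (l + (P.size + 2)), labelPrime l)]) ++ P.toFractran (l + 1))
      (B := B) (f := (labelPrime l, labelPrime (l + 1 + P.size)))
      (M := labelPrime l * registerValue τ) (fun f hf => by
        rcases List.mem_append.1 hf with hf | hf
        · exact ((hA' f hf).mono (by omega)).not_dvd _
        · exact (below_toFractran _ _ f hf).not_dvd _) (by ring)
    simpa [toFractran] using hs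

/-- The test for zero is the order of the fractions: the exit stands behind the entry, which fails
exactly for lack of the prime of `r`. -/
theorem steps_loop_exit {P : LoopProgram} {r : ℕ} {σ : ℕ →₀ ℕ} (hr : σ r = 0) (l : ℕ)
    (A B : FractranProgram) (hA : ∀ f ∈ A, Below l f) :
    FractranProgram.Steps (A ++ (loop r P).toFractran l ++ B)
      (labelPrime l * registerValue σ) (labelPrime (l + (P.size + 2)) * registerValue σ) := by
  have hs := steps_append (N := labelPrime l * registerValue σ)
    (A := A ++ [(labelPrime (l + 1), labelPrime l * registerPrime r)])
    (B := P.toFractran (l + 1) ++ [(labelPrime l, labelPrime (l + 1 + P.size))] ++ B)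
    (f := (labelPrime (l + (P.size + 2)), labelPrime l))
    (M := labelPrime (l + (P.size + 2)) * registerValue σ) (fun f hf => by
      rcases List.mem_append.1 hf with hf | hf
      · exact (hA f hf).not_dvd _
      · obtain rfl := List.mem_singleton.1 hf
        intro hdvd
        have hdvd := (Dvd.intro_left _ (PNat.mul_coe _ _).symm :
          (registerPrime r : ℕ) ∣ _).trans hdvd
        rcases (registerPrime_prime r).dvd_mul.1 hdvd with h | h
        · rcases (registerPrime_prime r).dvd_mul.1 h with h | h
          · exact not_registerPrime_dvd_labelPrime _ _ h
          · exact not_registerPrime_dvd_registerValue hr h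
        · exact not_registerPrime_dvd_labelPrime _ _ h) (by ring)
  simpa [toFractran] using hs

theorem Exec.simulates {P : LoopProgram} {σ τ : ℕ →₀ ℕ} (h : Exec P σ τ) : Simulates P σ τ := by
  induction h with
  | skip σ => exact fun l A B _ => ReflTransGen.refl
  | inc r σ =>
    intro l A B hA
    refine ReflTransGen.single ?_
    simp only [toFractran, List.append_assoc, List.cons_append]
    refine steps_append (fun f hf => (hA f hf).not_dvd _) ?_
    rw [registerValue_add, registerValue_single, PNat.mul_coe, size]
    ring
  | @seq P Q σ μ τ _ _ hP hQ =>
    intro l A B hA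
    have h1 := hP l A (Q.toFractran (l + P.size) ++ B) hA
    have h2 := hQ (l + P.size) (A ++ P.toFractran l) B fun f hf => by
      rcases List.mem_append.1 hf with hf | hf
      · exact (hA f hf).mono (by omega)
      · exact below_toFractran _ _ f hf
    simp only [List.append_assoc] at h1 h2
    simp only [toFractran, size, List.append_assoc, ← Nat.add_assoc]
    exact h1.trans h2
  | loop_zero hr => exact fun l A B hA => ReflTransGen.single (steps_loop_exit hr l A B hA)
  | loop_succ _ _ hP hloop =>
    exact fun l A B hA => (transGen_loop_body hP l A B hA).to_reflTransGen.trans (hloop l A B hA)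

/-! ### Fractran programs that search for a zero of a primitive recursive function -/

/-- If `G` adds a number depending on the registers `0` and `1` to the register `2`, this program
counts register `1` up until that number is zero. -/
def search (G : LoopProgram) : LoopProgram := loop 2 (seq (seq (clear 2) (inc 1)) G)

/-- On input `2`, write `x` into the register `0`, run `G`, and then `search G`. -/
noncomputable def searchFractran (G : LoopProgram) (x : ℕ) : FractranProgram :=
  (labelPrime 1 * registerPrime 0 ^ x, labelPrime 0) ::
    (G.toFractran 1 ++ G.search.toFractran (1 + G.size))

open Finsupp in
-- The states `c k` at the head of the search loop have register contents `x`, `k`, `g x k`. As long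
-- as `g x k` is not zero, `c k` leads to `c (k + 1)` in at least one step; otherwise the loop is
-- left.
theorem searchFractran_haltsOn_iff {G : LoopProgram} {g : ℕ → ℕ → ℕ}
    (hG : ∀ σ : ℕ →₀ ℕ, (∀ j, 3 ≤ j → σ j = 0) → Exec G σ (σ + single 2 (g (σ 0) (σ 1)))) (x : ℕ) :
    FractranProgram.HaltsOn (G.searchFractran x) 2 ↔ ∃ k, g x k = 0 := by
  let st : ℕ → ℕ →₀ ℕ := fun k => single 0 x + single 1 k
  have hst : ∀ k, Exec G (st k) (st k + single 2 (g x k)) := by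
    intro k
    have h := hG (st k) fun j hj => by
      simp only [st, Finsupp.add_apply]
      rw [single_eq_of_ne (by omega), single_eq_of_ne (by omega)]
      rfl
    simpa [st] using h
  let A : FractranProgram :=
    (labelPrime 1 * registerPrime 0 ^ x, labelPrime 0) :: G.toFractran 1
  have hstart : Below 1 (labelPrime 1 * registerPrime 0 ^ x, labelPrime 0) := by
    refine ⟨0, by omega, dvd_rfl, fun h => ?_⟩
    rw [PNat.mul_coe, PNat.pow_coe] at h
    rcases (labelPrime_prime 0).dvd_mul.1 h with h | h
    · exact absurd (labelPrime_dvd_labelPrime.1 h) (by omega)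
    · exact not_labelPrime_dvd_registerPrime _ _ ((labelPrime_prime 0).dvd_of_dvd_pow h)
  have hA : ∀ f ∈ A, Below (1 + G.size) f := by
    intro f hf
    rcases List.mem_cons.1 hf with rfl | hf
    · exact hstart.mono (by omega)
    · exact below_toFractran _ _ f hf
  have hF : G.searchFractran x = A ++ G.search.toFractran (1 + G.size) ++ [] := by
    simp [searchFractran, A]
  let c : ℕ → ℕ := fun k =>
    labelPrime (1 + G.size) * registerValue (st k + single 2 (g x k))
  have hinit : TransGen (G.searchFractran x).Steps 2 (c 0) := by
    refine TransGen.head' (b := labelPrime 1 * registerValue (st 0)) ?_ ?_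
    · refine steps_append (A := []) (by simp) ?_
      rw [PNat.mul_coe, PNat.pow_coe, coe_labelPrime_zero]
      simp only [st, single_zero, add_zero, registerValue_single]
      ring
    · have h := (hst 0).simulates 1 [(labelPrime 1 * registerPrime 0 ^ x, labelPrime 0)]
        (G.search.toFractran (1 + G.size)) (by simpa using hstart)
      simpa [searchFractran] using h
  have hnext : ∀ k, g x k ≠ 0 → TransGen (G.searchFractran x).Steps (c k) (c (k + 1)) := by
    intro k hk
    obtain ⟨n, hn⟩ := Nat.exists_eq_succ_of_ne_zero hk
    -- Entering the loop takes one unit from `g x k = n + 1`; the body clears the remaining `n`.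
    have hbody : Exec (seq (seq (clear 2) (inc 1)) G) (st k + single 2 n)
        (st (k + 1) + single 2 (g x (k + 1))) := by
      refine Exec.seq (Exec.seq (exec_clear (by simp [st]) n) (Exec.inc 1 _)) ?_
      have h : st k + single 1 1 = st (k + 1) := by simp only [st, single_add, add_assoc]
      rw [h]
      exact hst (k + 1)
    have h := transGen_loop_body (r := 2) hbody.simulates (1 + G.size) A [] hA
    rw [← search, ← hF, add_assoc, ← single_add] at h
    simpa only [c, hn] using h
  constructor
  · intro hhalt
    by_contra hne
    push Not at hne
    -- The infinite chain is `2, c 0, c 1, …`.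
    refine not_haltsOn_of_transGen (F := G.searchFractran x)
      (N := fun i => Nat.casesOn i 2 c) (fun i => ?_) hhalt
    cases i with
    | zero => exact hinit
    | succ i => exact hnext i (hne i)
  · intro hex
    classical
    have hreach : ∀ k ≤ Nat.find hex, ReflTransGen (G.searchFractran x).Steps 2 (c k) := by
      intro k
      induction k with
      | zero => exact fun _ => hinit.to_reflTransGen
      | succ k ih =>
        exact fun hk => (ih (by omega)).trans
          (hnext k (Nat.find_min hex (by omega))).to_reflTransGen
    refine HaltsOn.of_reaches (HaltsOn.of_steps
      (M := labelPrime (1 + G.size + G.search.size) *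
        registerValue (st (Nat.find hex) + single 2 (g x (Nat.find hex))))
      (haltsOn_of_step_eq_none ?_) ?_) (hreach _ le_rfl)
    -- The final label lies above every label at which some fraction applies.
    · refine step_eq_none fun f hf => ?_
      rw [hF, List.append_nil] at hf
      rcases List.mem_append.1 hf with hf | hf
      · exact ((hA f hf).mono (by omega)).not_dvd _
      · exact (below_toFractran _ _ f hf).not_dvd _
    · have h := steps_loop_exit (P := seq (seq (clear 2) (inc 1)) G) (r := 2)
        (σ := st (Nat.find hex) + single 2 (g x (Nat.find hex)))
        (by simp [st, Nat.find_spec hex]) (1 + G.size) A [] hA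
      rw [← search, ← hF] at h
      exact h

/-- Only the exponent in the first numerator varies with `x`; the rest of the program is a constant,
although its definition is noncomputable. -/
theorem primrec_searchFractran (G : LoopProgram) : Primrec G.searchFractran := by
  refine Primrec.list_cons.comp (Primrec.pair ?_ (Primrec.const _)) (Primrec.const _)
  refine (Primrec.subtype_val_iff (p := fun n : ℕ => 0 < n)
    (hp := Primrec.nat_lt.comp (Primrec.const 0) Primrec.id)).1 ?_
  have hpow : Primrec₂ ((· ^ ·) : ℕ → ℕ → ℕ) := Primrec₂.unpaired'.1 Nat.Primrec.pow
  refine (Primrec.nat_mul.comp (Primrec.const (labelPrime 1 : ℕ))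
    (hpow.comp (Primrec.const (registerPrime 0 : ℕ)) Primrec.id)).of_eq fun x => ?_
  change _ = ((labelPrime 1 * registerPrime 0 ^ x : ℕ+) : ℕ)
  rw [PNat.mul_coe, PNat.pow_coe]
  rfl

end LoopProgram

/-! ### Recursively enumerable sets and Fractran halting -/

theorem REPred.exists_primrec {p : ℕ → Prop} (hp : REPred p) :
    ∃ g : ℕ → ℕ → ℕ, Primrec₂ g ∧ ∀ x, p x ↔ ∃ k, g x k = 0 := by
  have hf : Partrec fun x => (Part.assert (p x) fun _ => Part.some ()).map fun _ => (0 : ℕ) :=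
    Partrec.map hp (Computable.const 0).to₂
  obtain ⟨c, hc⟩ := Nat.Partrec.Code.exists_code.1 (Partrec.nat_iff.1 hf)
  -- Evaluation with bound `k` is primitive recursive, and a computation converges iff it does so
  -- within some bound.
  refine ⟨fun x k => if (Nat.Partrec.Code.evaln k c x).isSome then 0 else 1, ?_, fun x => ?_⟩
  · refine Primrec.ite ?_ (Primrec.const 0) (Primrec.const 1)
    refine Primrec.primrecPred (Primrec.of_eq (f := fun a : ℕ × ℕ =>
      (Nat.Partrec.Code.evaln a.2 c a.1).isSome) ?_ fun a => by simp)
    exact Primrec.option_isSome.comp (Nat.Partrec.Code.primrec_evaln.comp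
      (Primrec.pair (Primrec.pair Primrec.snd (Primrec.const c)) Primrec.fst))
  · have hdom : p x ↔ (Nat.Partrec.Code.eval c x).Dom := by
      rw [hc]
      simp [Part.assert]
    rw [hdom, Part.dom_iff_mem]
    simp only [Nat.Partrec.Code.evaln_complete, ite_eq_left_iff, one_ne_zero, imp_false, not_not,
      Option.isSome_iff_exists, Option.mem_def]
    exact exists_comm

/-- The halting problem of Fractran programs on input `2` is hard for the recursively enumerable
sets. -/
theorem REPred.exists_fractran {p : ℕ → Prop} (hp : REPred p) :
    ∃ F : ℕ → FractranProgram, Primrec F ∧ ∀ x, p x ↔ (F x).HaltsOn 2 := by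
  obtain ⟨g, hg, hpg⟩ := hp.exists_primrec
  obtain ⟨G, hG⟩ := LoopProgram.computes_of_primrec (Nat.Primrec'.prim_iff₂.2 hg)
    -- Inputs in registers `0` and `1`, output in `2`, scratch registers from `3` on: the layout
    -- that `search` relies on.
    ![0, 1] 2 3 (by decide) (by decide) (by decide)
  refine ⟨G.searchFractran, G.primrec_searchFractran, fun x => ?_⟩
  rw [hpg, LoopProgram.searchFractran_haltsOn_iff (g := g)]
  intro σ hσ
  simpa [List.Vector.ofFn] using hG σ hσ

/-! ### The encoding of Fractran programs -/

namespace FractranProgram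

/-- Over the common denominator `d`, a numerator `z` applies iff `d ∣ N * z`, and this depends only
on `N % d`. -/
theorem step_eq_map_applicableNum (F : FractranProgram) (N : ℕ) :
    F.step N = (F.applicableNum (N % F.commonDen)).map fun z => N * z / F.commonDen := by
  have hden : ∀ f ∈ F, (f.2 : ℕ) ∣ F.commonDen := by
    induction F with
    | nil => simp
    | cons f F ih =>
      intro g hg
      rcases List.mem_cons.1 hg with rfl | hg
      · exact Nat.dvd_lcm_left _ _
      · exact (ih g hg).trans (Nat.dvd_lcm_right _ _)
  rw [step, applicableNum, commonNums]
  have hd := F.commonDen_pos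
  -- The common denominator has to stay fixed while the list shrinks in the induction below.
  generalize F.commonDen = d at hden hd ⊢
  have hiff : ∀ f ∈ F, (d ∣ N % d * ((f.1 : ℕ) * (d / (f.2 : ℕ))) ↔ (f.2 : ℕ) ∣ N * (f.1 : ℕ)) ∧
      N * ((f.1 : ℕ) * (d / (f.2 : ℕ))) / d = N * (f.1 : ℕ) / (f.2 : ℕ) := by
    intro f hf
    obtain ⟨c, rfl⟩ := hden f hf
    have hc : 0 < c := Nat.pos_of_mul_pos_left hd
    rw [Nat.mul_div_cancel_left c f.2.pos]
    constructor
    · rw [Nat.dvd_iff_mod_eq_zero, Nat.mod_mul_mod, ← Nat.dvd_iff_mod_eq_zero, ← mul_assoc]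
      exact Nat.mul_dvd_mul_iff_right hc
    · rw [← mul_assoc, Nat.mul_div_mul_right _ _ hc]
  clear hden
  induction F with
  | nil => rfl
  | cons f F ih =>
    have hf := hiff f (by simp)
    have ih := ih fun g hg => hiff g (by simp [hg])
    rw [List.map_cons, List.find?_cons, List.find?_cons]
    by_cases h : (f.2 : ℕ) ∣ N * (f.1 : ℕ)
    · simp only [h, decide_true, hf.1.2 h, Option.map_some, hf.2]
    · simp only [h, decide_false, hf.1.not.2 h, ih]

variable (F : FractranProgram)

/-- The image of a word at position `m` in the system that encodes `F`. -/
def encodingMap (m : ℕ) (w : List (Fin 6)) : List (Fin 6) :=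
  shiftedMap F.commonDen_pos F.encodingMorphism m w

theorem toPD0L_map (w : List (Fin 6)) : F.toPD0L.map w = F.encodingMap 0 w :=
  periodicMap_eq_shiftedMap _ _ _

theorem encodingMap_append (m : ℕ) (u v : List (Fin 6)) :
    F.encodingMap m (u ++ v) = F.encodingMap m u ++ F.encodingMap (m + u.length) v :=
  shiftedMap_append _ _ _ _ _

theorem encodingMap_singleton (m : ℕ) (a : Fin 6) :
    F.encodingMap m [a] =
      F.encodingMorphism ⟨m % F.commonDen, Nat.mod_lt m F.commonDen_pos⟩ a := by
  simp [encodingMap, shiftedMap]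

theorem encodingMap_blanks (m n : ℕ) : F.encodingMap m (blanks n) = [] := by
  refine shiftedMap_eq_nil _ _ _ _ fun a ha i => ?_
  rw [List.eq_of_mem_replicate ha]
  rfl

/-- The word `aᴺ b ⊔^(d-1)`, which encodes the number `N`. -/
def numberWord (N : ℕ) : List (Fin 6) := lowAs N ++ [letLowB] ++ blanks (F.commonDen - 1)

/-- The word `A ⊔^(d-1)`. -/
def quotientWord : List (Fin 6) := [letUpA] ++ blanks (F.commonDen - 1)

/-- The image `(A ⊔^(d-1))^q B ⊔^(d-1-r)` of the word for `N`, where `q` and `r` are the quotient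
and the remainder of `N` by `d`. -/
def divisionWord (N : ℕ) : List (Fin 6) :=
  (List.replicate (N / F.commonDen) F.quotientWord).flatten ++ [letUpB] ++
    blanks (F.commonDen - 1 - N % F.commonDen)

theorem length_numberWord (N : ℕ) : (F.numberWord N).length = N + F.commonDen := by
  have := F.commonDen_pos
  simp [numberWord, lowAs, blanks]
  omega

theorem length_quotientWord : F.quotientWord.length = F.commonDen := by
  have := F.commonDen_pos
  simp [quotientWord, blanks]
  omega

theorem length_divisionWord (N : ℕ) :
    (F.divisionWord N).length = N / F.commonDen * F.commonDen +
      (F.commonDen - N % F.commonDen) := by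
  have := Nat.mod_lt N F.commonDen_pos
  simp [divisionWord, blanks, length_quotientWord]
  omega

/-- Only the letters `a` at residue `d - 1` survive, and an aligned block of `N` letters has `N / d`
of them. -/
theorem encodingMap_lowAs {m : ℕ} (hm : F.commonDen ∣ m) (N : ℕ) :
    F.encodingMap m (lowAs N) =
      (List.replicate (N / F.commonDen) F.quotientWord).flatten := by
  induction N with
  | zero => simp [lowAs, encodingMap, shiftedMap]
  | succ N ih =>
    have hpos := F.commonDen_pos
    have hmod : (m + N) % F.commonDen = N % F.commonDen := by
      obtain ⟨c, rfl⟩ := hm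
      simp
    have hiff : N % F.commonDen = F.commonDen - 1 ↔ F.commonDen ∣ N + 1 := by
      have hlt := Nat.mod_lt N hpos
      have hN : N + 1 = F.commonDen * (N / F.commonDen) + (N % F.commonDen + 1) := by
        rw [← Nat.add_assoc, Nat.div_add_mod]
      rw [hN, Nat.dvd_add_right (dvd_mul_right _ _)]
      constructor
      · intro h
        rw [h, Nat.sub_add_cancel hpos]
      · intro h
        have := Nat.le_of_dvd (Nat.succ_pos _) h
        omega
    rw [lowAs, List.replicate_succ', ← lowAs, encodingMap_append, ih, encodingMap_singleton,
      Nat.succ_div]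
    simp only [lowAs, List.length_replicate]
    change _ ++ (if (m + N) % F.commonDen = F.commonDen - 1 then F.quotientWord else []) = _
    rw [hmod]
    by_cases h : F.commonDen ∣ N + 1
    · rw [if_pos (hiff.2 h), if_pos h, List.replicate_succ']
      simp
    · rw [if_neg (hiff.not.2 h), if_neg h]
      simp

theorem encodingMap_numberWord {m : ℕ} (hm : F.commonDen ∣ m) (N : ℕ) :
    F.encodingMap m (F.numberWord N) = F.divisionWord N := by
  have hmod : (m + N) % F.commonDen = N % F.commonDen := by
    obtain ⟨c, rfl⟩ := hm
    simp
  rw [numberWord, encodingMap_append, encodingMap_append, encodingMap_lowAs F hm,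
    encodingMap_blanks, encodingMap_singleton, List.append_nil, divisionWord, List.append_assoc]
  simp only [lowAs, List.length_replicate, hmod]
  rfl

/-- The word that encodes the number after a step, if there is one. -/
def stepWord (N : ℕ) : List (Fin 6) :=
  match F.step N with
  | some M => F.numberWord M
  | none => []

/-- A quotient word has length `d`, so every `A` stands at the same residue as the first. -/
theorem encodingMap_replicate_quotientWord {m : ℕ} {v : List (Fin 6)}
    (hv : F.encodingMorphism ⟨m % F.commonDen, Nat.mod_lt m F.commonDen_pos⟩ letUpA = v) (q : ℕ) :
    F.encodingMap m (List.replicate q F.quotientWord).flatten = (List.replicate q v).flatten := by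
  induction q with
  | zero => rfl
  | succ q ih =>
    rw [List.replicate_succ', List.replicate_succ', List.flatten_append, List.flatten_append,
      encodingMap_append, ih]
    simp only [List.flatten_singleton, List.length_flatten, List.map_replicate,
      List.sum_replicate_nat, length_quotientWord]
    rw [quotientWord, encodingMap_append, encodingMap_blanks, encodingMap_singleton,
      List.append_nil]
    simp only [Nat.add_mul_mod_self_right, hv]

theorem encodingMap_divisionWord {m N : ℕ} (hm : m % F.commonDen = N % F.commonDen) :
    F.encodingMap m (F.divisionWord N) = F.stepWord N := by
  have hpos := F.commonDen_pos
  have hB : F.encodingMap m (F.divisionWord N) =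
      F.encodingMap m (List.replicate (N / F.commonDen) F.quotientWord).flatten ++
        F.encodingMorphism ⟨N % F.commonDen, Nat.mod_lt N hpos⟩ letUpB := by
    rw [divisionWord, encodingMap_append, encodingMap_append, encodingMap_blanks,
      encodingMap_singleton, List.append_nil]
    simp only [List.length_flatten, List.map_replicate, List.sum_replicate_nat,
      length_quotientWord, Nat.add_mul_mod_self_right, hm]
  rw [hB, stepWord, step_eq_map_applicableNum]
  cases h : F.applicableNum (N % F.commonDen) with
  | none =>
    rw [encodingMap_replicate_quotientWord (v := []) F (by simp [encodingMorphism, letUpA, hm, h])]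
    simp [encodingMorphism, letUpB, h]
  | some z =>
    rw [encodingMap_replicate_quotientWord (v := lowAs z) F
      (by simp [encodingMorphism, letUpA, hm, h])]
    -- The first summand is the contribution of the letters `A`, the second that of `B`.
    have hcount : N * z / F.commonDen =
        N / F.commonDen * z + N % F.commonDen * z / F.commonDen := by
      nth_rw 1 [← Nat.div_add_mod N F.commonDen]
      rw [Nat.add_mul, Nat.mul_assoc, Nat.mul_add_div hpos]
    simp [encodingMorphism, letUpB, h, numberWord, lowAs, hcount]
    rw [← List.append_assoc, List.replicate_append_replicate]

/-- The prefix `u` lags one application of `H` behind: the image of `u` ends with the number word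
that directly follows `u`. Another application thus appends only the image of that number word,
placed at `u.length ≡ 0` modulo `d`; the one after it appends the image of the division word, placed
at residue `N % d`. -/
theorem exists_iterate_of_run {n N : ℕ} (hN : F.run 2 n = some N) :
    ∃ u : List (Fin 6), F.commonDen ∣ u.length ∧ F.toPD0L.map u = u ++ F.numberWord N ∧
      F.toPD0L.map^[2 * n + 1] F.toPD0L.start = F.toPD0L.map u ∧
      F.toPD0L.map^[2 * n + 2] F.toPD0L.start = F.toPD0L.map u ++ F.divisionWord N ∧
      F.toPD0L.map^[2 * n + 3] F.toPD0L.start =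
        F.toPD0L.map u ++ F.divisionWord N ++ F.stepWord N := by
  have hpos := F.commonDen_pos
  suffices h : ∃ u : List (Fin 6), F.commonDen ∣ u.length ∧
      F.toPD0L.map u = u ++ F.numberWord N ∧
      F.toPD0L.map^[2 * n + 1] F.toPD0L.start = F.toPD0L.map u by
    obtain ⟨u, hlen, hu, hiter⟩ := h
    have h2 : F.toPD0L.map^[2 * n + 2] F.toPD0L.start = F.toPD0L.map u ++ F.divisionWord N := by
      rw [Function.iterate_succ_apply', hiter, hu, toPD0L_map, encodingMap_append, ← toPD0L_map,
        hu, Nat.zero_add, encodingMap_numberWord F hlen]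
    refine ⟨u, hlen, hu, hiter, h2, ?_⟩
    have h3 := h2
    rw [Function.iterate_succ_apply', hiter] at h3
    rw [Function.iterate_succ_apply', h2, toPD0L_map F (_ ++ _), encodingMap_append, ← toPD0L_map,
      h3, encodingMap_divisionWord]
    obtain ⟨c, hc⟩ := hlen
    simp [hu, hc, length_numberWord, ← Nat.add_assoc]
  induction n generalizing N with
  | zero =>
    obtain rfl : 2 = N := Option.some.inj hN
    have hs : F.encodingMap 0 [letS] =
        [letS] ++ blanks (F.commonDen - 1) ++ F.numberWord 2 := by
      rw [encodingMap_singleton]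
      simp [encodingMorphism, numberWord, lowAs, List.replicate]
    have hu : F.toPD0L.map ([letS] ++ blanks (F.commonDen - 1)) =
        F.toPD0L.map F.toPD0L.start := by
      rw [toPD0L_map, toPD0L_map, encodingMap_append, encodingMap_blanks, List.append_nil]
      rfl
    -- The blanks are erased, so this word has the same image as the start word, but its length is
    -- `d`.
    refine ⟨[letS] ++ blanks (F.commonDen - 1), ?_, ?_, hu.symm⟩
    · have : ([letS] ++ blanks (F.commonDen - 1)).length = F.commonDen := by
        simp [blanks]
        omega
      rw [this]
    · rw [hu, toPD0L_map]
      exact hs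
  | succ n ih =>
    rw [run_succ] at hN
    obtain ⟨M, hM, hstep⟩ := Option.bind_eq_some_iff.1 hN
    obtain ⟨u, hlen, hu, hiter⟩ := ih hM
    have h2 : F.toPD0L.map (F.toPD0L.map u) = F.toPD0L.map u ++ F.divisionWord M := by
      conv_lhs => rw [hu]
      rw [toPD0L_map, encodingMap_append, ← toPD0L_map,
        Nat.zero_add, encodingMap_numberWord F hlen]
    -- The next `u` ends with the division word of `M`, whose image is the number word of the
    -- successor of `M`.
    refine ⟨F.toPD0L.map u ++ F.divisionWord M, ?_, ?_, ?_⟩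
    · rw [hu, List.length_append, List.length_append, length_numberWord, length_divisionWord]
      have hlt := Nat.mod_lt M hpos
      have hM := Nat.div_add_mod M F.commonDen
      have : u.length + (M + F.commonDen) + (M / F.commonDen * F.commonDen +
          (F.commonDen - M % F.commonDen)) =
          u.length + F.commonDen * (2 * (M / F.commonDen) + 2) := by
        rw [Nat.mul_comm (M / F.commonDen), Nat.mul_add, Nat.mul_left_comm]
        omega
      rw [this]
      exact hlen.add (dvd_mul_right _ _)
    · rw [toPD0L_map F (_ ++ _), encodingMap_append, ← toPD0L_map, h2, encodingMap_divisionWord,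
        stepWord, hstep]
      obtain ⟨c, hc⟩ := hlen
      simp [hu, hc, length_numberWord, ← Nat.add_assoc]
    · rw [show 2 * (n + 1) + 1 = 2 * n + 1 + 1 + 1 by ring, Function.iterate_succ_apply',
        Function.iterate_succ_apply', hiter, h2]

theorem toPD0L_productive_iff : F.toPD0L.Productive ↔ ¬ F.HaltsOn 2 := by
  rw [PD0LSystem.productive_iff, haltsOn_iff]
  constructor
  · rintro hprod ⟨n, hn⟩
    induction n with
    | zero => cases hn
    | succ n ih =>
      cases hN : F.run 2 n with
      | none => exact ih hN
      | some N =>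
        rw [run_succ, hN, Option.bind_some] at hn
        obtain ⟨u, -, -, -, h2, h3⟩ := F.exists_iterate_of_run hN
        refine hprod (2 * n + 2) (h3.trans ?_)
        rw [h2, stepWord, hn, List.append_nil]
  · intro hrun n hn
    cases hN : F.run 2 n with
    | none => exact hrun ⟨n, hN⟩
    | some N =>
      obtain ⟨u, -, -, h1, h2, -⟩ := F.exists_iterate_of_run hN
      -- Stationarity from stage `n` on would make stages `2 * n + 1` and `2 * n + 2` equal, but
      -- they differ by a division word, which contains `B`.
      rw [F.toPD0L.iterate_eq_of_le hn (by omega), ← F.toPD0L.iterate_eq_of_le hn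
        (show n ≤ 2 * n + 1 by omega), h1] at h2
      have := List.append_right_eq_self.1 h2.symm
      simp [divisionWord] at this

end FractranProgram

/-! ### Computability of the encoding -/

theorem PrimrecRel.nat_dvd : PrimrecRel ((· ∣ ·) : ℕ → ℕ → Prop) := by
  have h : PrimrecRel fun a b : ℕ => b % a = 0 :=
    Primrec.eq.comp₂ (Primrec.nat_mod.comp₂ Primrec₂.right Primrec₂.left) (Primrec₂.const 0)
  exact h.of_eq fun a b => (Nat.dvd_iff_mod_eq_zero).symm

/-- A bounded search for the greatest common divisor. The bound `a + b` also covers the case that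
one argument is zero; if both are, the search returns `0`. -/
theorem Primrec.nat_gcd : Primrec₂ Nat.gcd := by
  have h : Primrec fun a : ℕ × ℕ =>
      Nat.findGreatest (fun d => d ∣ a.1 ∧ d ∣ a.2) (a.1 + a.2) := by
    refine Primrec.nat_findGreatest (Primrec.nat_add.comp Primrec.fst Primrec.snd) ?_
    exact PrimrecPred.and
      (PrimrecRel.nat_dvd.comp Primrec.snd (Primrec.fst.comp Primrec.fst))
      (PrimrecRel.nat_dvd.comp Primrec.snd (Primrec.snd.comp Primrec.fst))
  refine h.of_eq fun ⟨a, b⟩ => ?_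
  rw [Nat.findGreatest_eq_iff]
  refine ⟨?_, fun _ => ⟨Nat.gcd_dvd_left a b, Nat.gcd_dvd_right a b⟩, ?_⟩
  · rcases Nat.eq_zero_or_pos a with rfl | ha
    · simp
    · exact (Nat.gcd_le_left b ha).trans (Nat.le_add_right a b)
  · rintro n hn hle ⟨h1, h2⟩
    simp only at hn hle h1 h2
    rcases Nat.eq_zero_or_pos (Nat.gcd a b) with h0 | hpos
    · rw [Nat.gcd_eq_zero_iff] at h0
      omega
    · exact absurd (Nat.le_of_dvd hpos (Nat.dvd_gcd h1 h2)) (by omega)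

theorem Primrec.nat_lcm : Primrec₂ Nat.lcm :=
  Primrec.nat_div.comp₂ Primrec.nat_mul Primrec.nat_gcd

theorem Primrec.list_replicate {α : Type*} [Primcodable α] (a : α) :
    Primrec fun n => List.replicate n a :=
  (Primrec.list_map Primrec.list_range (Primrec₂.const a)).of_eq fun n => by
    simp [List.map_const']

theorem Primrec.list_find? {α β : Type*} [Primcodable α] [Primcodable β] {f : α → List β}
    {p : α → β → Bool} (hf : Primrec f) (hp : Primrec₂ p) :
    Primrec fun a => (f a).find? (p a) := by
  have h : Primrec fun a =>
      (f a).foldr (fun b s => bif p a b then some b else s) (none : Option β) := by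
    refine Primrec.list_foldr (h := fun a (x : β × Option β) => bif p a x.1 then some x.1 else x.2)
      hf (Primrec.const none) ?_
    have hb : Primrec fun x : α × (β × Option β) => x.2.1 := Primrec.fst.comp Primrec.snd
    exact Primrec.cond (hp.comp Primrec.fst hb) (Primrec.option_some.comp hb)
      (Primrec.snd.comp Primrec.snd)
  refine h.of_eq fun a => ?_
  induction f a with
  | nil => rfl
  | cons b l ih =>
    rw [List.foldr_cons, ih, List.find?_cons]
    cases p a b <;> rfl

theorem Primrec.pnat_val : Primrec fun a : ℕ+ => (a : ℕ) :=
  Primrec.subtype_val (p := fun n : ℕ => 0 < n)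
    (hp := Primrec.nat_lt.comp (Primrec.const 0) Primrec.id)

namespace FractranProgram

theorem primrec_commonDen : Primrec commonDen := by
  refine Primrec.list_foldr (h := fun _ (x : (ℕ+ × ℕ+) × ℕ) => Nat.lcm (x.1.2 : ℕ) x.2)
    Primrec.id (Primrec.const 1) ?_
  have h : Primrec fun x : FractranProgram × ((ℕ+ × ℕ+) × ℕ) => x.2.1.2 :=
    Primrec.snd.comp (Primrec.fst.comp Primrec.snd)
  exact Primrec.nat_lcm.comp (Primrec.pnat_val.comp h) (Primrec.snd.comp Primrec.snd)

theorem primrec_commonNums : Primrec commonNums := by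
  refine Primrec.list_map Primrec.id ?_
  exact Primrec.nat_mul.comp (Primrec.pnat_val.comp (Primrec.fst.comp Primrec.snd))
    (Primrec.nat_div.comp (primrec_commonDen.comp Primrec.fst)
      (Primrec.pnat_val.comp (Primrec.snd.comp Primrec.snd)))

theorem primrec_applicableNum : Primrec₂ applicableNum := by
  refine Primrec.list_find? (f := fun a : FractranProgram × ℕ => a.1.commonNums)
    (p := fun a z => decide (a.1.commonDen ∣ a.2 * z)) (primrec_commonNums.comp Primrec.fst) ?_
  have h : PrimrecRel fun (a : FractranProgram × ℕ) (z : ℕ) => a.1.commonDen ∣ a.2 * z :=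
    PrimrecRel.nat_dvd.comp (primrec_commonDen.comp (Primrec.fst.comp Primrec.fst))
      (Primrec.nat_mul.comp (Primrec.snd.comp Primrec.fst) Primrec.snd)
  exact h.decide

/-- The table of the values of the `i`-th morphism of the encoding. -/
def encodingTable (F : FractranProgram) (i : ℕ) : List (List ℕ) :=
  [[0] ++ List.replicate (F.commonDen - 1) 1 ++ [2, 2, 4] ++ List.replicate (F.commonDen - 1) 1,
    [],
    if i = F.commonDen - 1 then [3] ++ List.replicate (F.commonDen - 1) 1 else [],
    ((F.applicableNum i).map fun z => List.replicate z 2).getD [],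
    [5] ++ List.replicate (F.commonDen - 1 - i) 1,
    ((F.applicableNum i).map fun z => List.replicate (i * z / F.commonDen) 2 ++ [4] ++
      List.replicate (F.commonDen - 1) 1).getD []]

theorem primrec_encodingTable : Primrec₂ encodingTable := by
  have hF : Primrec fun a : FractranProgram × ℕ => a.1.commonDen :=
    primrec_commonDen.comp Primrec.fst
  have hd : Primrec fun a : FractranProgram × ℕ => a.1.commonDen - 1 :=
    Primrec.nat_sub.comp hF (Primrec.const 1)
  have hi : Primrec fun a : FractranProgram × ℕ => a.2 := Primrec.snd
  have hblank : Primrec fun a : FractranProgram × ℕ => List.replicate (a.1.commonDen - 1) 1 :=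
    (Primrec.list_replicate 1).comp hd
  have hz : Primrec fun a : FractranProgram × ℕ => a.1.applicableNum a.2 :=
    primrec_applicableNum
  have cons {f : FractranProgram × ℕ → List ℕ} {g : FractranProgram × ℕ → List (List ℕ)}
      (hf : Primrec f) (hg : Primrec g) : Primrec fun a => f a :: g a :=
    Primrec.list_cons.comp hf hg
  refine cons ?_ (cons (Primrec.const []) (cons ?_ (cons ?_ (cons ?_
    (cons ?_ (Primrec.const []))))))
  · exact Primrec.list_append.comp (Primrec.list_append.comp
      (Primrec.list_append.comp (Primrec.const _) hblank) (Primrec.const _)) hblank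
  · exact Primrec.ite (Primrec.eq.comp hi hd)
      (Primrec.list_append.comp (Primrec.const _) hblank) (Primrec.const _)
  · exact Primrec.option_getD.comp (Primrec.option_map hz
      ((Primrec.list_replicate 2).comp Primrec.snd)) (Primrec.const _)
  · exact Primrec.list_append.comp (Primrec.const _)
      ((Primrec.list_replicate 1).comp (Primrec.nat_sub.comp hd hi))
  · refine Primrec.option_getD.comp (Primrec.option_map hz ?_) (Primrec.const _)
    refine Primrec.list_append.comp (Primrec.list_append.comp
      ((Primrec.list_replicate 2).comp ?_) (Primrec.const _)) (hblank.comp Primrec.fst)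
    exact Primrec.nat_div.comp (Primrec.nat_mul.comp (hi.comp Primrec.fst) Primrec.snd)
      (hF.comp Primrec.fst)

theorem code_toPD0L (F : FractranProgram) :
    PD0LSystem.code ⟨6, F.toPD0L⟩ =
      (6, (List.range F.commonDen).map F.encodingTable, [0]) := by
  have htable : ∀ i : Fin F.commonDen,
      (List.ofFn fun a => (F.encodingMorphism i a).map Fin.val) = F.encodingTable i := by
    intro i
    cases h : F.applicableNum i <;>
    · simp only [encodingMorphism, encodingTable, h, List.ofFn_succ, List.ofFn_zero]
      simp [blanks, lowAs, apply_ite (List.map Fin.val)]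
  refine Prod.ext rfl (Prod.ext ?_ rfl)
  change (List.ofFn fun i : Fin F.commonDen => List.ofFn fun a =>
    (F.encodingMorphism i a).map Fin.val) = (List.range F.commonDen).map F.encodingTable
  simp only [htable]
  exact List.ext_getElem (by simp) (by simp)

theorem primrec_code_toPD0L :
    Primrec fun F : FractranProgram => PD0LSystem.code ⟨6, F.toPD0L⟩ := by
  refine (Primrec.pair (Primrec.const 6) (Primrec.pair (Primrec.list_map
    (Primrec.list_range.comp primrec_commonDen) primrec_encodingTable)
    (Primrec.const [0]))).of_eq fun F => ?_
  rw [code_toPD0L]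

end FractranProgram

/-! ### Productivity is a co-recursively enumerable property of presentations -/

namespace PD0LSystem

/-- The map on words over `ℕ` given by the size of an alphabet, a table of morphisms, and a start
word. -/
def codeMap (c : ℕ × List (List (List ℕ)) × List ℕ) (w : List ℕ) : List ℕ :=
  (List.range w.length).flatMap fun i =>
    (c.2.1.getD (i % c.2.1.length) []).getD (w.getD i 0) []

/-- The default values in `codeMap` are never reached here: row indices are reduced modulo `p`, and
letters are below `n`. -/
theorem map_val_periodicMap {n p : ℕ} (hp : 0 < p) (h : Fin p → Fin n → List (Fin n))
    (s : List ℕ) (w : List (Fin n)) :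
    (periodicMap hp h w).map Fin.val =
      codeMap (n, List.ofFn fun i => List.ofFn fun a => (h i a).map Fin.val, s)
        (w.map Fin.val) := by
  rw [periodicMap, codeMap, List.map_flatten, List.flatMap_def]
  congr 1
  refine List.ext_getElem (by simp) fun i h1 h2 => ?_
  simp only [List.length_map, List.length_mapIdx] at h1
  simp [h1, Nat.mod_lt i hp]

/-- A presentation of a system is valid: it is the presentation of some system. -/
def ValidCode (c : ℕ × List (List (List ℕ)) × List ℕ) : Prop :=
  0 < c.2.1.length ∧ (∀ row ∈ c.2.1, row.length = c.1 ∧ ∀ w ∈ row, ∀ a ∈ w, a < c.1) ∧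
    (∀ a ∈ c.2.2, a < c.1) ∧ c.2.2 <+: codeMap c c.2.2

theorem validCode_iff (c : ℕ × List (List (List ℕ)) × List ℕ) :
    ValidCode c ↔ ∃ S : Σ n : ℕ, PD0LSystem (Fin n), code S = c := by
  constructor
  · obtain ⟨n, T, s⟩ := c
    rintro ⟨hT, hrow, hs, hpre⟩
    simp only at hT hrow hs hpre
    have lift : ∀ w : List ℕ, (∀ a ∈ w, a < n) → ∃ v : List (Fin n), v.map Fin.val = w :=
      fun w hw => ⟨w.pmap Fin.mk hw, by simp [List.map_pmap]⟩
    have hlen : ∀ i : Fin T.length, (T[i]).length = n := fun i =>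
      (hrow _ (List.getElem_mem _)).1
    have hentry : ∀ (i : Fin T.length) (a : Fin n), ∃ v : List (Fin n),
        v.map Fin.val = (T[i])[(a : ℕ)]'(by rw [hlen]; exact a.2) := fun i a =>
      lift _ ((hrow _ (List.getElem_mem _)).2 _ (List.getElem_mem _))
    choose h hh using hentry
    obtain ⟨v, rfl⟩ := lift s hs
    have htable : (List.ofFn fun i => List.ofFn fun a => (h i a).map Fin.val) = T := by
      refine List.ext_getElem (by simp) fun i h1 h2 => ?_
      refine List.ext_getElem (by simpa using (hlen ⟨i, h2⟩).symm) fun a h3 h4 => ?_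
      simp [hh]
    have hstart : v <+: periodicMap hT h v := by
      rw [← List.prefix_map_iff_of_injective Fin.val_injective,
        map_val_periodicMap hT h (v.map Fin.val), htable]
      exact hpre
    exact ⟨⟨n, ⟨T.length, hT, h, v, hstart⟩⟩, by simp only [code, htable]⟩
  · rintro ⟨⟨n, S⟩, rfl⟩
    refine ⟨by simpa [code] using S.period_pos, ?_, ?_, ?_⟩
    · intro row hr
      obtain ⟨i, rfl⟩ := List.mem_ofFn.1 hr
      refine ⟨by simp [code], fun w hw a ha => ?_⟩
      obtain ⟨b, rfl⟩ := List.mem_ofFn.1 hw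
      obtain ⟨x, -, rfl⟩ := List.mem_map.1 ha
      exact x.2
    · intro a ha
      obtain ⟨x, -, rfl⟩ := List.mem_map.1 ha
      exact x.2
    · have h := (List.prefix_map_iff_of_injective Fin.val_injective).2 S.start_prefix
      rwa [map_val_periodicMap _ _ (S.start.map Fin.val)] at h

theorem map_val_iterate {n : ℕ} (S : PD0LSystem (Fin n)) (k : ℕ) :
    (S.map^[k] S.start).map Fin.val =
      (codeMap (code ⟨n, S⟩))^[k] (code ⟨n, S⟩).2.2 := by
  induction k with
  | zero => rfl
  | succ k ih =>
    rw [Function.iterate_succ_apply', Function.iterate_succ_apply', ← ih]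
    exact map_val_periodicMap _ _ _ _

/-- Productivity of a system is visible in the iterates of `codeMap` on its code. Invalidity does
not involve `k` and is put under the quantifier to obtain a single search. -/
theorem not_exists_code_eq_iff (c : ℕ × List (List (List ℕ)) × List ℕ) :
    (¬ ∃ S : Σ n : ℕ, PD0LSystem (Fin n), code S = c ∧ S.2.Productive) ↔
      ∃ k, ¬ ValidCode c ∨ (codeMap c)^[k + 1] c.2.2 = (codeMap c)^[k] c.2.2 := by
  rw [← not_iff_not, not_not]
  push Not
  rw [forall_and]
  simp only [validCode_iff, forall_const]
  constructor
  · rintro ⟨⟨n, S⟩, rfl, hS⟩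
    refine ⟨⟨⟨n, S⟩, rfl⟩, fun k hk => S.productive_iff.1 hS k ?_⟩
    rw [← map_val_iterate, ← map_val_iterate] at hk
    exact List.map_injective_iff.2 Fin.val_injective hk
  · rintro ⟨⟨⟨n, S⟩, rfl⟩, h⟩
    refine ⟨⟨n, S⟩, rfl, S.productive_iff.2 fun k hk => h k ?_⟩
    rw [← map_val_iterate, ← map_val_iterate, hk]

theorem primrec_codeMap : Primrec₂ codeMap := by
  refine Primrec.list_flatMap (Primrec.list_range.comp
    (Primrec.list_length.comp Primrec.snd)) ?_
  have hT : Primrec fun x : ((ℕ × List (List (List ℕ)) × List ℕ) × List ℕ) × ℕ =>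
      x.1.1.2.1 := Primrec.fst.comp (Primrec.snd.comp (Primrec.fst.comp Primrec.fst))
  exact (Primrec.list_getD []).comp ((Primrec.list_getD []).comp hT
    (Primrec.nat_mod.comp Primrec.snd (Primrec.list_length.comp hT)))
    ((Primrec.list_getD 0).comp (Primrec.snd.comp Primrec.fst) Primrec.snd)

theorem primrecPred_validCode : PrimrecPred ValidCode := by
  have hn : Primrec fun c : ℕ × List (List (List ℕ)) × List ℕ => c.1 := Primrec.fst
  have hT : Primrec fun c : ℕ × List (List (List ℕ)) × List ℕ => c.2.1 :=
    Primrec.fst.comp Primrec.snd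
  have hs : Primrec fun c : ℕ × List (List (List ℕ)) × List ℕ => c.2.2 :=
    Primrec.snd.comp Primrec.snd
  have hword : PrimrecRel fun (w : List ℕ) (n : ℕ) => ∀ a ∈ w, a < n :=
    Primrec.nat_lt.forall_mem_list
  have hrow : PrimrecRel fun (row : List (List ℕ)) (n : ℕ) =>
      row.length = n ∧ ∀ w ∈ row, ∀ a ∈ w, a < n :=
    PrimrecPred.and (Primrec.eq.comp (Primrec.list_length.comp Primrec.fst) Primrec.snd)
      hword.forall_mem_list
  refine PrimrecPred.and (Primrec.nat_lt.comp (Primrec.const 0) (Primrec.list_length.comp hT))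
    (PrimrecPred.and (hrow.forall_mem_list.comp hT hn) (PrimrecPred.and (hword.comp hs hn) ?_))
  refine PrimrecPred.of_eq (Primrec.eq.comp hs (Primrec.list_take.comp
    (Primrec.list_length.comp hs) (primrec_codeMap.comp Primrec.id hs))) fun c => ?_
  exact List.prefix_iff_eq_take.symm

end PD0LSystem

theorem PrimrecRel.rePred_exists {α : Type*} [Primcodable α] {R : α → ℕ → Prop}
    (hR : PrimrecRel R) : REPred fun a => ∃ k, R a k := by
  classical
  have h : Partrec fun a => Nat.rfind fun k => Part.some (decide (R a k)) :=
    Partrec.rfind (Primrec.to_comp hR.decide).partrec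
  refine h.dom_re.of_eq fun a => ?_
  refine Nat.rfind_dom.trans ⟨?_, ?_⟩
  · rintro ⟨k, hk, -⟩
    exact ⟨k, of_decide_eq_true (Part.mem_some_iff.1 hk).symm⟩
  · rintro ⟨k, hk⟩
    exact ⟨k, Part.mem_some_iff.2 (decide_eq_true hk).symm, fun _ => trivial⟩

theorem PD0LSystem.isPi01_productive :
    IsPi01 fun c => ∃ S : Σ n : ℕ, PD0LSystem (Fin n), code S = c ∧ S.2.Productive := by
  have hs : Primrec fun x : (ℕ × List (List (List ℕ)) × List ℕ) × ℕ => x.1.2.2 :=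
    Primrec.snd.comp (Primrec.snd.comp Primrec.fst)
  have hstep : Primrec₂ fun (x : (ℕ × List (List (List ℕ)) × List ℕ) × ℕ) (w : List ℕ) =>
      codeMap x.1 w := primrec_codeMap.comp (Primrec.fst.comp Primrec.fst) Primrec.snd
  have hR : PrimrecRel fun (c : ℕ × List (List (List ℕ)) × List ℕ) (k : ℕ) =>
      ¬ ValidCode c ∨ (codeMap c)^[k + 1] c.2.2 = (codeMap c)^[k] c.2.2 :=
    PrimrecPred.or (primrecPred_validCode.comp Primrec.fst).not
      (Primrec.eq.comp (Primrec.nat_iterate (Primrec.succ.comp Primrec.snd) hs hstep)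
        (Primrec.nat_iterate Primrec.snd hs hstep))
  exact hR.rePred_exists.of_eq fun c => (not_exists_code_eq_iff c).symm

theorem mainTheorem5 :
    IsPi01Complete PD0LSystem.code
      (fun S : Σ n : ℕ, PD0LSystem (Fin n) => S.2.Productive) ∧
    (Computable fun F : FractranProgram => PD0LSystem.code ⟨6, F.toPD0L⟩) ∧
    ∀ F : FractranProgram, F.toPD0L.Productive ↔ ¬ F.HaltsOn 2 := by
  refine ⟨⟨PD0LSystem.isPi01_productive, fun A hA => ?_⟩,
    FractranProgram.primrec_code_toPD0L.to_comp, FractranProgram.toPD0L_productive_iff⟩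
  obtain ⟨F, hF, hAF⟩ := REPred.exists_fractran hA
  refine ⟨fun x => ⟨6, (F x).toPD0L⟩, (FractranProgram.primrec_code_toPD0L.comp hF).to_comp,
    fun x => ?_⟩
  exact (not_iff_comm.1 (hAF x)).symm.trans (FractranProgram.toPD0L_productive_iff (F x)).symm
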